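/- Let $S$ be a scheme on which $2$ is not a zero divisor, i.e. $2$ is not a zero divisor in $\Gamma(U,\mathcal O_S)$ for every open $U\subseteq S$. **Definitions.** A quadratic algebra over $S$ is an $\mathcal O_S$-algebra $\mathcal C$ that is locally free of rank $2$ as an $\mathcal O_S$-module. Its *type* is the triple $(\Delta_W(\mathcal C),\Pi(\mathcal C),(\mathcal C/\mathcal O_S)^\vee)$, where $\Delta_W(\mathcal C)$ is the global section of $((\mathcal C/\mathcal O_S)^\vee)^{\otimes 2}$ and $\Pi(\mathcal C)$ the global section of $(\mathcal C/\mathcal O_S)^\vee/2(\mathcal C/\mathcal O_S)^\vee$ such that, for every open $U$ and every $\mathcal O_U$-basis $(1,\tau)$ of $\mathcal C_{|U}$, with $\tau^2+r\tau+s=0$, $r,s\in\Gamma(U,\mathcal O_S)$, one has $\Delta_W(\mathcal C)_{|U}=(r^2-4s)\,\overline\tau^\vee\otimes\overline\tau^\vee$ and $\Pi(\mathcal C)_{|U}$ is the class of $r\,\overline\tau^\vee$; here $\overline\tau$ is the image of $\tau$ in $\mathcal C/\mathcal O_S$ and $\overline\tau^\vee$ its dual basis. More generally, consider triples $(\Delta_W,\Pi,\mathcal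 N)$ with $\mathcal N$ a locally free $\mathcal O_S$-module of rank $1$, $\Delta_W\in\Gamma(S,\mathcal N^{\otimes 2})$ and $\Pi\in\Gamma(S,\mathcal N/2\mathcal N)$; an isomorphism $(\Delta_W,\Pi,\mathcal N)\cong(\Delta_W',\Pi',\mathcal N')$ is an isomorphism of $\mathcal O_S$-modules $f:\mathcal N\to\mathcal N'$ with $f^{\otimes 2}(\Delta_W)=\Delta_W'$ and $\overline f(\Pi)=\Pi'$, where $\overline f:\mathcal N/2\mathcal N\to\mathcal N'/2\mathcal N'$ is induced by $f$. A triple is *valid* if it is isomorphic to the type of some quadratic algebra over $S$. **Statement.** Let $(\Delta_W,\Pi,\mathcal N)$ be such a triple. 1. The triple $(\Delta_W,\Pi,\mathcal N)$ is valid if and only if there is an open covering $(U_i)_i$ of $S$ such that for all $i$: (a) $\mathcal N_{|U_i}$ is free (of rank $1$); (b) $\Pi_{|U_i}\in\Gamma(U_i,\mathcal N/2\mathcal N)$ lifts to some $\tilde\Pi_i\in\Gamma(U_i,\mathcal N)$; (c) for every such lift $\tilde\Pi_i$, $\Delta_{W|U_i}\equiv\tilde\Pi_i^{\otimes 2}\pmod{4\Gamma(U_i,\mathcal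 N^{\otimes 2})}$. 2. Suppose $(U_i)_i$ is an open covering satisfying (a), (b), (c). For each $i$ choose any generator $\nu_i$ of $\mathcal N_{|U_i}$ and any lift $\tilde\Pi_i\in\Gamma(U_i,\mathcal N)$ of $\Pi_{|U_i}$. Then there are $\tilde p_i,d_i\in\Gamma(U_i,\mathcal O_S)$ with $\tilde\Pi_i=\tilde p_i\nu_i$ and $\Delta_{W|U_i}=d_i\,\nu_i\otimes\nu_i$, the element $d_i-\tilde p_i^2$ is divisible by $4$ in $\Gamma(U_i,\mathcal O_S)$, and the free algebras $$\Omega_i=\mathcal O_{U_i}[\omega_i]\big/\big\langle\omega_i^2+\tilde p_i\omega_i-\tfrac{d_i-\tilde p_i^2}{4}\big\rangle$$ glue to a quadratic algebra $\Omega$ over $S$ of type (isomorphic to) $(\Delta_W,\Pi,\mathcal N)$. The glueing is given on $U_i\cap U_j$ by $$\omega_i=\varepsilon_{i,j}\omega_j+\frac{\varepsilon_{i,j}\tilde p_j-\tilde p_i}{2},$$ where $\varepsilon_{i,j}\in\Gamma(U_i\cap U_j,\mathcal O_S)^\times$ is the unit with $\nu_j=\varepsilon_{i,j}\nu_i$ (in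 particular, the numerator is divisible by $2$ in $\Gamma(U_i\cap U_j,\mathcal O_S)$), and the isomorphism of types $(\Omega/\mathcal O_S)^\vee\cong\mathcal N$ sends $\overline{\omega_i}^\vee$ to $\nu_i$ for all $i$. -/

import Mathlib

open CategoryTheory AlgebraicGeometry Opposite Limits
universe u

namespace SchemeQuadratic

noncomputable section
variable {S : Scheme.{u}}

/-- The restriction map `Γ(U, 𝒪) → Γ(V, 𝒪)` for `V ≤ U`. -/
def resO {U V : S.Opens} (h : V ≤ U) : Γ(S, U) →+* Γ(S, V) :=
  (S.presheaf.map (homOfLE h).op).hom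

/-- The restriction map `Γ(U, M) → Γ(V, M)` for `V ≤ U`. -/
def res (M : S.Modules) {U V : S.Opens} (h : V ≤ U) : Γ(M, U) →+ Γ(M, V) :=
  (M.presheaf.map (homOfLE h).op).hom

lemma resO_resO {U V W : S.Opens} (h : V ≤ U) (h' : W ≤ V) (a : Γ(S, U)) :
    resO h' (resO h a) = resO (h'.trans h) a := by
  change (S.presheaf.map (homOfLE h).op ≫ S.presheaf.map (homOfLE h').op) a = _
  rw [← Functor.map_comp]; rfl

lemma res_res (M : S.Modules) {U V W : S.Opens} (h : V ≤ U) (h' : W ≤ V) (m : Γ(M, U)) :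
    res M h' (res M h m) = res M (h'.trans h) m := by
  change (M.presheaf.map (homOfLE h).op ≫ M.presheaf.map (homOfLE h').op) m = _
  rw [← Functor.map_comp]; rfl

lemma res_smul (M : S.Modules) {U V : S.Opens} (h : V ≤ U) (a : Γ(S, U)) (m : Γ(M, U)) :
    res M h (a • m) = resO h a • res M h m :=
  Scheme.Modules.map_smul M (homOfLE h) a m

lemma resO_glue {ι : Type u} (W : ι → S.Opens) (V : S.Opens) (hW : ∀ i, W i ≤ V)
    (hV : V ≤ iSup W) (s : ∀ i, Γ(S, W i))
    (hs : ∀ i j, resO (inf_le_left : W i ⊓ W j ≤ W i) (s i) = resO inf_le_right (s j)) :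
    ∃! t : Γ(S, V), ∀ i, resO (hW i) t = s i :=
  S.sheaf.existsUnique_gluing' W V (fun i => homOfLE (hW i)) hV s hs

lemma resO_ext {ι : Type u} (W : ι → S.Opens) (V : S.Opens) (hW : ∀ i, W i ≤ V)
    (hV : V ≤ iSup W) (s t : Γ(S, V)) (h : ∀ i, resO (hW i) s = resO (hW i) t) : s = t :=
  S.sheaf.eq_of_locally_eq' W V (fun i => homOfLE (hW i)) hV s t h

/-- Families, indexed by the open `V ≤ U`, of `Γ(V, 𝒪)`-linear forms on `Γ(V, M)`; a ring element
`a ∈ Γ(U, 𝒪)` acts on the `V`-component through its restriction to `V`. -/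
def DualFamily (M : S.Modules) (U : S.Opens) : Type u :=
  ∀ V : {V : S.Opens // V ≤ U}, Γ(M, V.1) →ₗ[Γ(S, V.1)] Γ(S, V.1)

instance (M : S.Modules) (U : S.Opens) : AddCommGroup (DualFamily M U) :=
  inferInstanceAs (AddCommGroup
    (∀ V : {V : S.Opens // V ≤ U}, Γ(M, V.1) →ₗ[Γ(S, V.1)] Γ(S, V.1)))

instance (M : S.Modules) (U : S.Opens) : Module Γ(S, U) (DualFamily M U) :=
  @Pi.module {V : S.Opens // V ≤ U} (fun V => Γ(M, V.1) →ₗ[Γ(S, V.1)] Γ(S, V.1)) Γ(S, U) _ _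
    (fun V => Module.compHom _ (resO V.2))

lemma DualFamily.add_apply {M : S.Modules} {U : S.Opens} (φ ψ : DualFamily M U)
    (V : {V : S.Opens // V ≤ U}) (m : Γ(M, V.1)) : (φ + ψ) V m = φ V m + ψ V m := rfl

lemma DualFamily.zero_apply {M : S.Modules} {U : S.Opens}
    (V : {V : S.Opens // V ≤ U}) (m : Γ(M, V.1)) : (0 : DualFamily M U) V m = 0 := rfl

lemma DualFamily.smul_apply {M : S.Modules} {U : S.Opens} (a : Γ(S, U)) (φ : DualFamily M U)
    (V : {V : S.Opens // V ≤ U}) (m : Γ(M, V.1)) : (a • φ) V m = resO V.2 a * φ V m := rfl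

/-- The `Γ(U, 𝒪)`-module `Hom(M|_U, 𝒪_U)`: the families of linear forms that commute with
restriction. -/
def dualSections (M : S.Modules) (U : S.Opens) : Submodule Γ(S, U) (DualFamily M U) where
  carrier := {φ | ∀ (V W : {V : S.Opens // V ≤ U}) (h : W.1 ≤ V.1) (m : Γ(M, V.1)),
    resO h (φ V m) = φ W (res M h m)}
  add_mem' {φ ψ} hφ hψ V W h m := by
    simp only [DualFamily.add_apply, map_add, hφ V W h m, hψ V W h m]
  zero_mem' V W h m := by simp only [DualFamily.zero_apply, map_zero]
  smul_mem' a φ hφ V W h m := by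
    simp only [DualFamily.smul_apply, map_mul, hφ V W h m, resO_resO]

/-- Restriction `Hom(M|_U, 𝒪_U) → Hom(M|_U', 𝒪_U')`. -/
def dualRes (M : S.Modules) {U U' : S.Opens} (h : U' ≤ U) :
    dualSections M U →+ dualSections M U' where
  toFun φ := ⟨fun V => φ.1 ⟨V.1, V.2.trans h⟩, fun V W hVW m =>
    φ.2 ⟨V.1, V.2.trans h⟩ ⟨W.1, W.2.trans h⟩ hVW m⟩
  map_zero' := rfl
  map_add' _ _ := rfl

/-- The presheaf `U ↦ Hom(M|_U, 𝒪_U)`. -/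
def dualPresheaf (M : S.Modules) : TopCat.Presheaf Ab.{u} S where
  obj U := AddCommGrpCat.of (dualSections M U.unop)
  map f := AddCommGrpCat.ofHom (dualRes M (leOfHom f.unop))
  map_id _ := rfl
  map_comp _ _ := rfl

instance (M : S.Modules) (U : (TopologicalSpace.Opens S)ᵒᵖ) :
    Module (S.ringCatSheaf.obj.obj U) ((dualPresheaf M).obj U) :=
  inferInstanceAs (Module Γ(S, U.unop) (dualSections M U.unop))

lemma dualPresheaf_map_smul (M : S.Modules) ⦃U V : (TopologicalSpace.Opens S)ᵒᵖ⦄ (f : U ⟶ V)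
    (r : S.ringCatSheaf.obj.obj U) (m : (dualPresheaf M).obj U) :
    (dualPresheaf M).map f (r • m) = S.ringCatSheaf.obj.map f r • (dualPresheaf M).map f m := by
  refine Subtype.ext (funext fun W => LinearMap.ext fun x => ?_)
  exact congrArg (· * _) (resO_resO (leOfHom f.unop) W.2 (show Γ(S, U.unop) from r)).symm

lemma dualPresheaf_isSheaf (M : S.Modules) : (dualPresheaf M).IsSheaf := by
  rw [TopCat.Presheaf.isSheaf_iff_isSheafUniqueGluing]
  intro ι U sf hsf
  have hsf' : ∀ (i j : ι) (V : S.Opens) (hi : V ≤ U i) (hj : V ≤ U j) (m : Γ(M, V)),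
      (show dualSections M (U i) from sf i).1 ⟨V, hi⟩ m =
        (show dualSections M (U j) from sf j).1 ⟨V, hj⟩ m := by
    intro i j V hi hj m
    have h := hsf i j
    have h2 := congrArg
      (fun φ : dualSections M (U i ⊓ U j) => φ.1 ⟨V, le_inf hi hj⟩ m) h
    exact h2
  have key : ∀ (V : {V : S.Opens // V ≤ iSup U}) (m : Γ(M, V.1)),
      ∃! t : Γ(S, V.1), ∀ i, resO (inf_le_left : V.1 ⊓ U i ≤ V.1) t =
        (show dualSections M (U i) from sf i).1 ⟨V.1 ⊓ U i, inf_le_right⟩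
          (res M inf_le_left m) := by
    intro V m
    refine resO_glue (fun i => V.1 ⊓ U i) V.1 (fun i => inf_le_left) ?_ _ ?_
    · rw [← inf_iSup_eq]; exact le_inf le_rfl V.2
    · intro i j
      rw [(show dualSections M (U i) from sf i).2 ⟨V.1 ⊓ U i, inf_le_right⟩
          ⟨(V.1 ⊓ U i) ⊓ (V.1 ⊓ U j), inf_le_left.trans inf_le_right⟩ inf_le_left,
        (show dualSections M (U j) from sf j).2 ⟨V.1 ⊓ U j, inf_le_right⟩
          ⟨(V.1 ⊓ U i) ⊓ (V.1 ⊓ U j), inf_le_right.trans inf_le_right⟩ inf_le_right,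
        res_res, res_res]
      exact hsf' i j _ _ _ _
  have uniq : ∀ (V : {V : S.Opens // V ≤ iSup U}) (s t : Γ(S, V.1)),
      (∀ i, resO (inf_le_left : V.1 ⊓ U i ≤ V.1) s = resO inf_le_left t) → s = t := by
    intro V s t h
    refine resO_ext (fun i => V.1 ⊓ U i) V.1 (fun i => inf_le_left) ?_ s t h
    rw [← inf_iSup_eq]; exact le_inf le_rfl V.2
  choose g hg hg' using key
  let G : DualFamily M (iSup U) := fun V =>
    { toFun := g V
      map_add' := fun a b => by
        refine uniq V _ _ fun i => ?_
        simp only [map_add, hg]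
      map_smul' := fun a b => by
        refine uniq V _ _ fun i => ?_
        simp only [smul_eq_mul, map_mul, hg, res_smul, map_smul, RingHom.id_apply] }
  have hGV : ∀ (V : {V : S.Opens // V ≤ iSup U}) (i : ι) (h : V.1 ≤ U i) (m : Γ(M, V.1)),
      G V m = (show dualSections M (U i) from sf i).1 ⟨V.1, h⟩ m := by
    intro V i h m
    refine uniq V _ _ fun j => ?_
    rw [(show dualSections M (U i) from sf i).2 ⟨V.1, h⟩ ⟨V.1 ⊓ U j, inf_le_left.trans h⟩]
    exact (hg V m j).trans (hsf' _ _ _ _ _ _)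
  have hG : G ∈ dualSections M (iSup U) := by
    intro V W h m
    refine uniq W _ _ fun i => ?_
    have e : resO (inf_le_left : W.1 ⊓ U i ≤ W.1) (G W (res M h m)) = _ := hg W (res M h m) i
    rw [e, resO_resO, res_res]
    have := congrArg (resO (inf_le_inf_right (U i) h)) (hg V m i)
    rw [resO_resO] at this
    refine this.trans ?_
    rw [(show dualSections M (U i) from sf i).2 ⟨V.1 ⊓ U i, inf_le_right⟩
      ⟨W.1 ⊓ U i, inf_le_right⟩, res_res]
  refine ⟨(⟨G, hG⟩ : dualSections M (iSup U)), fun i => ?_, fun t ht => ?_⟩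
  · refine Subtype.ext (funext fun W => LinearMap.ext fun x => ?_)
    exact hGV ⟨W.1, _⟩ i W.2 x
  · refine Subtype.ext (funext fun W => LinearMap.ext fun x => ?_)
    refine hg' W x _ fun i => ?_
    rw [(show dualSections M (iSup U) from t).2 W ⟨W.1 ⊓ U i, inf_le_left.trans W.2⟩]
    rw [← ht i]
    rfl

/-- The dual `M^∨ = ℋom(M, 𝒪_S)` of an `𝒪_S`-module. -/
def dual (M : S.Modules) : S.Modules where
  val := PresheafOfModules.ofPresheaf (dualPresheaf M) (dualPresheaf_map_smul M)
  isSheaf := dualPresheaf_isSheaf M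

/-- The linear form on `Γ(U, M)` given by a section of `M^∨` over `U`. -/
def evalDual {M : S.Modules} {U : S.Opens} (φ : Γ(dual M, U)) : Γ(M, U) →ₗ[Γ(S, U)] Γ(S, U) :=
  (show dualSections M U from φ).1 ⟨U, le_rfl⟩

/-! ## Tensor products and reduction modulo two -/

/-- The presheaf tensor product `U ↦ Γ(U, M) ⊗ Γ(U, N)`. -/
def preTensor (M N : S.Modules) : S.PresheafOfModules :=
  PresheafOfModules.Monoidal.tensorObj (R := S.presheaf) M.val N.val

/-- The tensor product `M ⊗ N` of `𝒪_S`-modules: the sheafification of the presheaf tensor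
product. -/
def tensor (M N : S.Modules) : S.Modules :=
  (PresheafOfModules.sheafification (𝟙 S.ringCatSheaf.obj)).obj (preTensor M N)

/-- The morphism `f ⊗ g : M ⊗ N → M' ⊗ N'`. -/
def tensorMap {M M' N N' : S.Modules} (f : M ⟶ M') (g : N ⟶ N') : tensor M N ⟶ tensor M' N' :=
  (PresheafOfModules.sheafification (𝟙 S.ringCatSheaf.obj)).map
    (PresheafOfModules.Monoidal.tensorHom (R := S.presheaf) f.val g.val)

/-- The section `a ⊗ b` of `M ⊗ N` over `U`, for sections `a` of `M` and `b` of `N` over `U`. -/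
def tmul {M N : S.Modules} {U : S.Opens} (a : Γ(M, U)) (b : Γ(N, U)) : Γ(tensor M N, U) :=
  (CategoryTheory.toSheafify (Opens.grothendieckTopology S) (preTensor M N).presheaf).app (op U)
    (show (preTensor M N).obj (op U) from
      TensorProduct.tmul Γ(S, U) (M := Γ(M, U)) (N := Γ(N, U)) a b)

/-- The quotient sheaf `N/2N`. -/
def modTwo (N : S.Modules) : S.Modules := cokernel ((2 : ℤ) • 𝟙 N)

/-- The projection `N → N/2N`. -/
def toModTwo (N : S.Modules) : N ⟶ modTwo N := cokernel.π ((2 : ℤ) • 𝟙 N)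

/-- The morphism `N/2N → N'/2N'` induced by `f : N → N'`. -/
def modTwoMap {N N' : S.Modules} (f : N ⟶ N') : modTwo N ⟶ modTwo N' :=
  cokernel.map _ _ f f (by simp)

/-! ## Local freeness -/

/-- The sections `e₁, …, eₙ` of `M` over `U` form an `𝒪_U`-basis of `M|_U`, that is, the morphism
`𝒪_U^n → M|_U` they define is bijective on the sections over every open `V ≤ U`. -/
def IsBasisOn (M : S.Modules) {U : S.Opens} {n : ℕ} (e : Fin n → Γ(M, U)) : Prop :=
  ∀ (V : S.Opens) (h : V ≤ U),
    Function.Bijective fun c : Fin n → Γ(S, V) => ∑ i, c i • res M h (e i)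

/-- `M` is locally free of rank `n`. -/
def IsLocallyFreeOfRank (M : S.Modules) (n : ℕ) : Prop :=
  ∀ x : S, ∃ U : S.Opens, x ∈ U ∧ ∃ e : Fin n → Γ(M, U), IsBasisOn M e

/-- `2` is not a zero divisor on `S`: it is not a zero divisor in `Γ(U, 𝒪_S)`, for every open
`U`. -/
def TwoIsRegular (S : Scheme.{u}) : Prop :=
  ∀ (U : S.Opens) (a : Γ(S, U)), 2 * a = 0 → a = 0

/-! ## Quadratic algebras -/

/-- `𝒪_S` as a module over itself. -/
def structureModule (S : Scheme.{u}) : S.Modules := SheafOfModules.unit S.ringCatSheaf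

/-- A (unital, associative) `𝒪_S`-algebra: an `𝒪_S`-module `C` with a structure morphism
`𝒪_S → C`, whose value at `1` is the unit, and an associative `𝒪_S`-bilinear multiplication. -/
structure OAlgebra (S : Scheme.{u}) where
  toModule : S.Modules
  unit : structureModule S ⟶ toModule
  mul : ∀ U : S.Opens, Γ(toModule, U) →ₗ[Γ(S, U)] Γ(toModule, U) →ₗ[Γ(S, U)] Γ(toModule, U)
  res_mul : ∀ (U V : S.Opens) (h : V ≤ U) (a b : Γ(toModule, U)),
    res toModule h (mul U a b) = mul V (res toModule h a) (res toModule h b)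
  mul_assoc : ∀ (U : S.Opens) (a b c : Γ(toModule, U)),
    mul U (mul U a b) c = mul U a (mul U b c)
  one_mul : ∀ (U : S.Opens) (a : Γ(toModule, U)),
    mul U (unit.app U (show Γ(structureModule S, U) from (1 : Γ(S, U)))) a = a
  mul_one : ∀ (U : S.Opens) (a : Γ(toModule, U)),
    mul U a (unit.app U (show Γ(structureModule S, U) from (1 : Γ(S, U)))) = a

namespace OAlgebra

variable (C : OAlgebra S)

/-- The unit section over `U`. -/
def one (U : S.Opens) : Γ(C.toModule, U) :=
  C.unit.app U (show Γ(structureModule S, U) from (1 : Γ(S, U)))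

/-- A quadratic algebra is an `𝒪_S`-algebra that is locally free of rank `2`. -/
def IsQuadratic : Prop := IsLocallyFreeOfRank C.toModule 2

/-- The quotient module `C/𝒪_S`. -/
def quot : S.Modules := cokernel C.unit

/-- The class `τ̄` in `C/𝒪_S` of a section `τ` of `C`. -/
def bar {U : S.Opens} (τ : Γ(C.toModule, U)) : Γ(C.quot, U) := (cokernel.π C.unit).app U τ

/-- `(1, τ)` is an `𝒪_U`-basis of `C|_U` and `τ² + r τ + s = 0`; in other words
`C|_U = 𝒪_U[τ]/⟨τ² + r τ + s⟩`. -/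
structure IsGenerator {U : S.Opens} (τ : Γ(C.toModule, U)) (r s : Γ(S, U)) : Prop where
  basis : IsBasisOn C.toModule ![C.one U, τ]
  eqn : C.mul U τ τ + r • τ + s • C.one U = 0

/-- The section `μ` of `(C/𝒪_S)^∨` over `U` is the dual basis `τ̄^∨` of `τ̄`, for `(1, τ)` a basis of
`C|_U`: it takes the value `1` on the generator `τ̄` of `(C/𝒪_S)|_U`. -/
def IsDualBar {U : S.Opens} (τ : Γ(C.toModule, U)) (μ : Γ(dual C.quot, U)) : Prop :=
  evalDual μ (C.bar τ) = 1

/-- `Δ` is the Wood-discriminant `Δ_W(C)`: the global section of `((C/𝒪_S)^∨)^{⊗ 2}` whose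
restriction to each `U` on which `C` has a basis `(1, τ)` with `τ² + r τ + s = 0` is
`(r² - 4 s) τ̄^∨ ⊗ τ̄^∨`. -/
def IsWoodDiscriminant (Δ : Γ(tensor (dual C.quot) (dual C.quot), (⊤ : S.Opens))) : Prop :=
  ∀ (U : S.Opens) (τ : Γ(C.toModule, U)) (r s : Γ(S, U)), C.IsGenerator τ r s →
    ∃ μ : Γ(dual C.quot, U), C.IsDualBar τ μ ∧
      res _ (le_top : U ≤ ⊤) Δ = (r ^ 2 - 4 * s) • tmul μ μ

/-- `Π` is the parity `Π(C)`: the global section of `(C/𝒪_S)^∨ / 2 (C/𝒪_S)^∨` whose restriction to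
each `U` on which `C` has a basis `(1, τ)` with `τ² + r τ + s = 0` is the class of `r τ̄^∨`. -/
def IsParity (P : Γ(modTwo (dual C.quot), (⊤ : S.Opens))) : Prop :=
  ∀ (U : S.Opens) (τ : Γ(C.toModule, U)) (r s : Γ(S, U)), C.IsGenerator τ r s →
    ∃ μ : Γ(dual C.quot, U), C.IsDualBar τ μ ∧
      res _ (le_top : U ≤ ⊤) P = (toModTwo (dual C.quot)).app U (r • μ)

end OAlgebra

/-! ## Types -/

/-- The isomorphism `f : N ≅ N'` is an isomorphism of types `(Δ, Π, N) ≅ (Δ', Π', N')`. -/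
structure IsTypeIso {N N' : S.Modules} (f : N ≅ N')
    (Δ : Γ(tensor N N, (⊤ : S.Opens))) (P : Γ(modTwo N, (⊤ : S.Opens)))
    (Δ' : Γ(tensor N' N', (⊤ : S.Opens))) (P' : Γ(modTwo N', (⊤ : S.Opens))) : Prop where
  disc : (tensorMap f.hom f.hom).app ⊤ Δ = Δ'
  parity : (modTwoMap f.hom).app ⊤ P = P'

/-- The isomorphism `f : (C/𝒪_S)^∨ ≅ N` identifies the type
`(Δ_W(C), Π(C), (C/𝒪_S)^∨)` of `C` with `(Δ, Π, N)`. -/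
def HasTypeVia (C : OAlgebra S) {N : S.Modules} (f : dual C.quot ≅ N)
    (Δ : Γ(tensor N N, (⊤ : S.Opens))) (P : Γ(modTwo N, (⊤ : S.Opens))) : Prop :=
  ∃ (Δ₀ : Γ(tensor (dual C.quot) (dual C.quot), (⊤ : S.Opens)))
    (P₀ : Γ(modTwo (dual C.quot), (⊤ : S.Opens))),
    C.IsWoodDiscriminant Δ₀ ∧ C.IsParity P₀ ∧ IsTypeIso f Δ₀ P₀ Δ P

/-- The triple `(Δ, Π, N)` is valid: it is isomorphic to the type of some quadratic algebra. -/
def IsValid (N : S.Modules) (Δ : Γ(tensor N N, (⊤ : S.Opens)))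
    (P : Γ(modTwo N, (⊤ : S.Opens))) : Prop :=
  ∃ (C : OAlgebra S) (f : dual C.quot ≅ N), C.IsQuadratic ∧ HasTypeVia C f Δ P

/-- The section `t` of `N` over `U` lifts the restriction of `Π` to `U`. -/
def IsLift {N : S.Modules} (P : Γ(modTwo N, (⊤ : S.Opens))) {U : S.Opens} (t : Γ(N, U)) : Prop :=
  (toModTwo N).app U t = res _ (le_top : U ≤ ⊤) P

/-- The open covering `(U_i)` of `S` satisfies the three local conditions: `N|_{U_i}` is free (of
rank `1`), `Π|_{U_i}` lifts to a section of `N` over `U_i`, and each lift `t` satisfies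
`Δ|_{U_i} ≡ t ⊗ t` modulo `4 Γ(U_i, N^{⊗ 2})`. -/
structure IsAdaptedCover (N : S.Modules) (Δ : Γ(tensor N N, (⊤ : S.Opens)))
    (P : Γ(modTwo N, (⊤ : S.Opens))) {ι : Type u} (U : ι → S.Opens) : Prop where
  covers : iSup U = ⊤
  free : ∀ i, ∃ ν : Γ(N, U i), IsBasisOn N ![ν]
  exists_lift : ∀ i, ∃ t : Γ(N, U i), IsLift P t
  congr : ∀ (i : ι) (t : Γ(N, U i)), IsLift P t →
    ∃ c : Γ(tensor N N, U i),
      res _ (le_top : U i ≤ ⊤) Δ = tmul t t + (4 : Γ(S, U i)) • c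

/-- The algebra `Ω`, with the sections `ω_i` over `U_i`, is the glueing of the free algebras
`Ω_i = 𝒪_{U_i}[ω_i]/⟨ω_i² + p_i ω_i - a_i⟩` along the isomorphisms given on `U_i ∩ U_j` by
`ω_i = ε (ω_j + (p_j - p_i ε⁻¹)/2) = ε ω_j + b`, where `ε` is the unit with `ν_j = ε ν_i` and
`2 b = ε p_j - p_i`. -/
structure IsGlueing {N : S.Modules} {ι : Type u} {U : ι → S.Opens} (ν : ∀ i, Γ(N, U i))
    (p a : ∀ i, Γ(S, U i)) (Ω : OAlgebra S) (ω : ∀ i, Γ(Ω.toModule, U i)) : Prop where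
  generator : ∀ i, Ω.IsGenerator (ω i) (p i) (-a i)
  transition : ∀ i j, ∃ (ε : Γ(S, U i ⊓ U j)ˣ) (b : Γ(S, U i ⊓ U j)),
    res N inf_le_right (ν j) = (ε : Γ(S, U i ⊓ U j)) • res N inf_le_left (ν i) ∧
    2 * b = (ε : Γ(S, U i ⊓ U j)) * resO inf_le_right (p j) - resO inf_le_left (p i) ∧
    res Ω.toModule inf_le_left (ω i) =
      (ε : Γ(S, U i ⊓ U j)) • res Ω.toModule inf_le_right (ω j) + b • Ω.one (U i ⊓ U j)

end

end SchemeQuadratic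

open SchemeQuadratic

namespace SchemeQuadratic

noncomputable section

variable {S : Scheme.{u}}

/-! ## Sections of sheaves of modules -/

/-! Everything is local once sections can be compared on overlaps, and regularity of 2 makes halves
unique, so that local halves glue.

From an algebra to the congruences: near every point the unit of a quadratic algebra belongs to a
basis `(1, τ)` (`IsQuadratic.exists_isGenerator`). If `τ² + rτ + s = 0` and `ν` is the image of the
dual basis of `τ̄`, then `Δ = (r² - 4s) ν ⊗ ν` and `Π` is the class of `r ν`. Any other lift of `Π`
is `(r + 2b) ν`, because the kernel of `N → N/2N` on sections of a free `N` is exactly `2N`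
(`exists_eq_two_mul_of_toModTwo_eq`); its square differs from `r² - 4s` by a multiple of 4.

From the congruences to an algebra: write the lifts as `p_i ν_i` and `Δ = (p_i² + 4 a_i) ν_i ⊗ ν_i`.
If `ν_j = ε ν_i`, comparing `Π` on the overlap shows that 2 divides `ε p_j - p_i`, and comparing `Δ`
gives `p_i² + 4 a_i = ε² (p_j² + 4 a_j)` (`isGlueingDatum_of_res_eq`). With `δ_i = 2 ω_i + p_i` one
has `δ_i² = p_i² + 4 a_i`, and the required transition is simply `δ_i = ε δ_j`. A section `x_i + y_i
ω_i` has double `(2 x_i - p_i y_i) + y_i δ_i`, so the glued module consists of families of pairs for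
which `2 x_i - p_i y_i` is independent of `i` and `y_i ν_j = y_j ν_i`. This description is symmetric
and chooses neither units nor halves, so no cocycle condition has to be checked. The equality of
discriminants is what makes it stable under multiplication (`IsGlueingDatum.mul_mem`), and over
`U_i` the `i`-th pair determines the section, which gives the basis `(1, ω_i)`
(`IsGlueingDatum.exists_isGlueing`).

The dual bases of the `ω_i` transform like the `ν_i`, hence `(Ω/𝒪)^∨ ≅ N` (`IsGlueing.exists_iso`).
The type may be checked on the covering, since the formulas for discriminant and parity are stable
under change of generator (`IsGenerator.exists_compare`). -/

@[simp] lemma resO_self {U : S.Opens} (h : U ≤ U) (a : Γ(S, U)) : resO h a = a := by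
  change S.presheaf.map (𝟙 _) a = a
  rw [CategoryTheory.Functor.map_id]; rfl

@[simp] lemma res_self (M : S.Modules) {U : S.Opens} (h : U ≤ U) (m : Γ(M, U)) :
    res M h m = m := by
  change M.presheaf.map (𝟙 _) m = m
  rw [CategoryTheory.Functor.map_id]; rfl

lemma app_res {M N : S.Modules} (f : M ⟶ N) {U V : S.Opens} (h : V ≤ U) (m : Γ(M, U)) :
    f.app V (res M h m) = res N h (f.app U m) :=
  NatTrans.naturality_apply f.mapPresheaf (homOfLE h).op m

lemma res_glue (M : S.Modules) {ι : Type u} (W : ι → S.Opens) (V : S.Opens) (hW : ∀ i, W i ≤ V)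
    (hV : V ≤ iSup W) (s : ∀ i, Γ(M, W i))
    (hs : ∀ i j, res M (inf_le_left : W i ⊓ W j ≤ W i) (s i) = res M inf_le_right (s j)) :
    ∃! t : Γ(M, V), ∀ i, res M (hW i) t = s i :=
  TopCat.Sheaf.existsUnique_gluing' (⟨M.presheaf, M.isSheaf⟩ : TopCat.Sheaf Ab S) W V
    (fun i => homOfLE (hW i)) hV s hs

lemma res_ext (M : S.Modules) {ι : Type u} (W : ι → S.Opens) (V : S.Opens) (hW : ∀ i, W i ≤ V)
    (hV : V ≤ iSup W) (s t : Γ(M, V)) (h : ∀ i, res M (hW i) s = res M (hW i) t) : s = t :=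
  TopCat.Sheaf.eq_of_locally_eq' (⟨M.presheaf, M.isSheaf⟩ : TopCat.Sheaf Ab S) W V
    (fun i => homOfLE (hW i)) hV s t h

lemma le_iSup_of_forall_mem {V : S.Opens} {W : V → S.Opens} (hW : ∀ x : V, x.1 ∈ W x) :
    V ≤ iSup W :=
  fun x hx => TopologicalSpace.Opens.mem_iSup.mpr ⟨⟨x, hx⟩, hW ⟨x, hx⟩⟩

lemma resO_ext_local {V : S.Opens} {s t : Γ(S, V)}
    (h : ∀ x ∈ V, ∃ (W : S.Opens) (hW : W ≤ V), x ∈ W ∧ resO hW s = resO hW t) : s = t := by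
  choose W hW hx he using fun x : V => h x.1 x.2
  exact resO_ext W V hW (le_iSup_of_forall_mem hx) s t he

lemma res_ext_local {M : S.Modules} {V : S.Opens} {s t : Γ(M, V)}
    (h : ∀ x ∈ V, ∃ (W : S.Opens) (hW : W ≤ V), x ∈ W ∧ res M hW s = res M hW t) : s = t := by
  choose W hW hx he using fun x : V => h x.1 x.2
  exact res_ext M W V hW (le_iSup_of_forall_mem hx) s t he

lemma res_ext_cover {ι : Type*} {U : ι → S.Opens} (hU : iSup U = ⊤) {M : S.Modules} {V : S.Opens}
    {s t : Γ(M, V)}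
    (h : ∀ i (W : S.Opens) (hW : W ≤ V), W ≤ U i → res M hW s = res M hW t) : s = t :=
  res_ext_local fun x hx => by
    obtain ⟨i, hi⟩ := TopologicalSpace.Opens.mem_iSup.mp (hU ▸ trivial : x ∈ iSup U)
    exact ⟨V ⊓ U i, inf_le_left, ⟨hx, hi⟩, h i _ _ inf_le_right⟩

/-! ## Bases -/

lemma isBasisOn_singleton {M : S.Modules} {U : S.Opens} {e : Γ(M, U)} :
    IsBasisOn M ![e] ↔ ∀ (V : S.Opens) (h : V ≤ U),
      Function.Bijective fun a : Γ(S, V) => a • res M h e := by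
  refine forall₂_congr fun V h => ?_
  rw [← (Equiv.funUnique (Fin 1) Γ(S, V)).symm.bijective.of_comp_iff]
  simp [Function.comp_def]

lemma isBasisOn_pair {M : S.Modules} {U : S.Opens} {e f : Γ(M, U)} :
    IsBasisOn M ![e, f] ↔ ∀ (V : S.Opens) (h : V ≤ U),
      Function.Bijective fun a : Γ(S, V) × Γ(S, V) => a.1 • res M h e + a.2 • res M h f := by
  refine forall₂_congr fun V h => ?_
  rw [← (finTwoArrowEquiv Γ(S, V)).symm.bijective.of_comp_iff]
  simp [Function.comp_def]

lemma IsBasisOn.restrict {M : S.Modules} {U V : S.Opens} {n : ℕ} {e : Fin n → Γ(M, U)}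
    (he : IsBasisOn M e) (h : V ≤ U) : IsBasisOn M fun i => res M h (e i) := by
  intro W hW
  simpa only [res_res] using he W (hW.trans h)

lemma IsBasisOn.restrict_singleton {M : S.Modules} {U V : S.Opens} {e : Γ(M, U)}
    (he : IsBasisOn M ![e]) (h : V ≤ U) : IsBasisOn M ![res M h e] := by
  convert! he.restrict h using 1
  ext i; fin_cases i; rfl

lemma IsBasisOn.smul_injective {M : S.Modules} {U V : S.Opens} {e : Γ(M, U)}
    (he : IsBasisOn M ![e]) (h : V ≤ U) {a b : Γ(S, V)}
    (hab : a • res M h e = b • res M h e) : a = b :=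
  (isBasisOn_singleton.mp he V h).1 hab

lemma IsBasisOn.exists_smul {M : S.Modules} {U V : S.Opens} {e : Γ(M, U)}
    (he : IsBasisOn M ![e]) (h : V ≤ U) (m : Γ(M, V)) :
    ∃ a : Γ(S, V), m = a • res M h e := by
  obtain ⟨a, ha⟩ := (isBasisOn_singleton.mp he V h).2 m
  exact ⟨a, ha.symm⟩

/-- A section is a basis if it generates locally and has no annihilator. -/
lemma isBasisOn_of_local {M : S.Modules} {U : S.Opens} {e : Γ(M, U)}
    (hinj : ∀ (V : S.Opens) (h : V ≤ U) (a : Γ(S, V)), a • res M h e = 0 → a = 0)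
    (hsurj : ∀ (V : S.Opens) (h : V ≤ U) (m : Γ(M, V)), ∀ x ∈ V,
      ∃ (W : S.Opens) (hW : W ≤ V), x ∈ W ∧ ∃ a : Γ(S, W), res M hW m = a • res M (hW.trans h) e) :
    IsBasisOn M ![e] := by
  rw [isBasisOn_singleton]
  refine fun V h => ⟨fun a b hab => sub_eq_zero.mp (hinj V h _ ?_), fun m => ?_⟩
  · rw [sub_smul]; exact sub_eq_zero.mpr hab
  choose W hW hx a ha using fun x : V => hsurj V h m x.1 x.2
  -- Since `e` has no annihilator, the local coefficients agree on overlaps and glue.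
  obtain ⟨t, ht, -⟩ := resO_glue W V hW (le_iSup_of_forall_mem hx) a fun x y => by
    refine sub_eq_zero.mp (hinj _ (inf_le_left.trans ((hW x).trans h)) _ ?_)
    have h1 := congrArg (res M (inf_le_left : W x ⊓ W y ≤ W x)) (ha x)
    have h2 := congrArg (res M (inf_le_right : W x ⊓ W y ≤ W y)) (ha y)
    rw [res_smul, res_res, res_res] at h1 h2
    rw [sub_smul, ← h1, ← h2, sub_self]
  refine ⟨t, res_ext M W V hW (le_iSup_of_forall_mem hx) _ _ fun x => ?_⟩
  rw [ha, res_smul, res_res, ht]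

/-! ## Sheafification -/

/-- The sheaf of modules associated with a presheaf of modules. -/
abbrev assocSheaf (P : S.PresheafOfModules) : S.Modules :=
  (PresheafOfModules.sheafification (𝟙 S.ringCatSheaf.obj)).obj P

/-- The section of the associated sheaf given by a section of a presheaf of modules. -/
def toAssoc (P : S.PresheafOfModules) (U : S.Opens) : P.obj (op U) →+ Γ(assocSheaf P, U) :=
  ((CategoryTheory.toSheafify (Opens.grothendieckTopology S) P.presheaf).app (op U)).hom

lemma toAssoc_smul (P : S.PresheafOfModules) (U : S.Opens) (a : Γ(S, U)) (m : P.obj (op U)) :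
    toAssoc P U ((show S.ringCatSheaf.obj.obj (op U) from a) • m) = a • toAssoc P U m :=
  ((PresheafOfModules.toSheafify (𝟙 S.ringCatSheaf.obj)
    (CategoryTheory.toSheafify (Opens.grothendieckTopology S) P.presheaf)).app (op U)).hom.map_smul
      (show S.ringCatSheaf.obj.obj (op U) from a) m

lemma res_toAssoc (P : S.PresheafOfModules) {U V : S.Opens} (h : V ≤ U) (m : P.obj (op U)) :
    res (assocSheaf P) h (toAssoc P U m) = toAssoc P V (P.presheaf.map (homOfLE h).op m) :=
  (NatTrans.naturality_apply (CategoryTheory.toSheafify (Opens.grothendieckTopology S) P.presheaf)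
    (homOfLE h).op m).symm

lemma exists_toAssoc_eq (P : S.PresheafOfModules) {U : S.Opens} (m : Γ(assocSheaf P, U))
    {x : S} (hx : x ∈ U) : ∃ (V : S.Opens) (h : V ≤ U), x ∈ V ∧
      ∃ n : P.obj (op V), toAssoc P V n = res (assocSheaf P) h m := by
  obtain ⟨V, f, ⟨n, hn⟩, hV⟩ := Presheaf.imageSieve_mem (Opens.grothendieckTopology S)
    (CategoryTheory.toSheafify (Opens.grothendieckTopology S) P.presheaf) (U := op U) m x hx
  exact ⟨V, leOfHom f, hV, n, hn⟩

lemma exists_map_eq_zero_of_toAssoc_eq_zero (P : S.PresheafOfModules) {U : S.Opens}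
    {m : P.obj (op U)} (hm : toAssoc P U m = 0) {x : S} (hx : x ∈ U) :
    ∃ (V : S.Opens) (h : V ≤ U), x ∈ V ∧ P.presheaf.map (homOfLE h).op m = 0 := by
  obtain ⟨V, f, hn, hV⟩ := Presheaf.equalizerSieve_mem (Opens.grothendieckTopology S)
    (CategoryTheory.toSheafify (Opens.grothendieckTopology S) P.presheaf) (X := op U) m 0
    (hm.trans (map_zero (toAssoc P U)).symm) x hx
  exact ⟨V, leOfHom f, hV, Eq.trans hn (map_zero (P.presheaf.map f.op).hom)⟩

lemma assocSheaf_map_toAssoc {P Q : S.PresheafOfModules} (f : P ⟶ Q) (U : S.Opens)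
    (m : P.obj (op U)) :
    Scheme.Modules.Hom.app (M := assocSheaf P) (N := assocSheaf Q)
      ((PresheafOfModules.sheafification (𝟙 S.ringCatSheaf.obj)).map f) U (toAssoc P U m) =
      toAssoc Q U (f.app (op U) m) :=
  ConcreteCategory.congr_hom (congr_app (CategoryTheory.toSheafify_naturality
    (Opens.grothendieckTopology S) ((PresheafOfModules.toPresheaf _).map f)) (op U)).symm m

/-! ## Tensor products -/

section Tensor

variable {M N M' N' : S.Modules}

lemma smul_tmul {U : S.Opens} (c : Γ(S, U)) (a : Γ(M, U)) (b : Γ(N, U)) :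
    tmul (c • a) b = c • tmul a b := by
  refine Eq.trans ?_ (toAssoc_smul (preTensor M N) U c _)
  exact congrArg (toAssoc (preTensor M N) U) (TensorProduct.smul_tmul' (R := Γ(S, U)) c a b).symm

lemma tmul_smul {U : S.Opens} (c : Γ(S, U)) (a : Γ(M, U)) (b : Γ(N, U)) :
    tmul a (c • b) = c • tmul a b := by
  refine Eq.trans ?_ (toAssoc_smul (preTensor M N) U c _)
  exact congrArg (toAssoc (preTensor M N) U) (TensorProduct.tmul_smul (R := Γ(S, U)) c a b)

lemma smul_tmul_smul {U : S.Opens} (c d : Γ(S, U)) (a : Γ(M, U)) (b : Γ(N, U)) :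
    tmul (c • a) (d • b) = (c * d) • tmul a b := by
  rw [smul_tmul, tmul_smul, mul_smul]

lemma res_tmul {U V : S.Opens} (h : V ≤ U) (a : Γ(M, U)) (b : Γ(N, U)) :
    res (tensor M N) h (tmul a b) = tmul (res M h a) (res N h b) :=
  res_toAssoc (preTensor M N) h _

lemma tensorMap_tmul (f : M ⟶ M') (g : N ⟶ N') {U : S.Opens} (a : Γ(M, U)) (b : Γ(N, U)) :
    (tensorMap f g).app U (tmul a b) = tmul (f.app U a) (g.app U b) :=
  assocSheaf_map_toAssoc (PresheafOfModules.Monoidal.tensorHom (R := S.presheaf) f.val g.val) U _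

end Tensor

section Tensor

variable {M N : S.Modules}

lemma IsBasisOn.exists_linearForm {U : S.Opens} {e : Γ(M, U)} (he : IsBasisOn M ![e]) :
    ∃ φ : Γ(M, U) →ₗ[Γ(S, U)] Γ(S, U), φ e = 1 := by
  have hb := isBasisOn_singleton.mp he U le_rfl
  refine ⟨(LinearEquiv.ofBijective (LinearMap.toSpanSingleton Γ(S, U) Γ(M, U) e)
    (by simp only [res_self] at hb; exact hb)).symm.toLinearMap, ?_⟩
  refine (LinearEquiv.symm_apply_eq _).mpr ?_
  change e = (1 : Γ(S, U)) • e
  rw [one_smul]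

/-- Sections of the sheaf tensor product come locally from the presheaf one, where every tensor is a
sum of multiples of `e ⊗ f`; a product of coordinate forms detects the coefficient. -/
lemma isBasisOn_tmul {U : S.Opens} {e : Γ(M, U)} {f : Γ(N, U)} (he : IsBasisOn M ![e])
    (hf : IsBasisOn N ![f]) : IsBasisOn (tensor M N) ![tmul e f] := by
  refine isBasisOn_of_local (fun V h a ha => resO_ext_local fun x hx => ?_) fun V h m x hx => ?_
  · rw [res_tmul, ← smul_tmul] at ha
    obtain ⟨W, hW, hxW, h0⟩ := exists_map_eq_zero_of_toAssoc_eq_zero (preTensor M N)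
      (m := show (preTensor M N).obj (op V) from
        TensorProduct.tmul Γ(S, V) (M := Γ(M, V)) (N := Γ(N, V)) (a • res M h e) (res N h f)) ha hx
    refine ⟨W, hW, hxW, ?_⟩
    obtain ⟨φ, hφ⟩ := (he.restrict_singleton (hW.trans h)).exists_linearForm
    obtain ⟨ψ, hψ⟩ := (hf.restrict_singleton (hW.trans h)).exists_linearForm
    have h1 : TensorProduct.tmul Γ(S, W) (M := Γ(M, W)) (N := Γ(N, W))
        (res M hW (a • res M h e)) (res N hW (res N h f)) = 0 := h0
    -- Multiplying the two coordinate forms sends `e ⊗ f` to 1, hence reads off the coefficient.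
    have h2 := congrArg (LinearMap.mul' Γ(S, W) Γ(S, W) ∘ₗ TensorProduct.map φ ψ) h1
    simpa [res_smul, res_res, hφ, hψ] using h2
  · obtain ⟨W, hW, hxW, n, hn⟩ := exists_toAssoc_eq (preTensor M N) (U := V) m hx
    refine ⟨W, hW, hxW, ?_⟩
    suffices H : ∀ n : TensorProduct Γ(S, W) Γ(M, W) Γ(N, W),
        ∃ a : Γ(S, W), toAssoc (preTensor M N) W n =
          a • res (tensor M N) (hW.trans h) (tmul e f) by
      obtain ⟨a, ha⟩ := H n
      exact ⟨a, hn.symm.trans ha⟩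
    intro n
    induction n using TensorProduct.induction_on with
    | zero => exact ⟨0, by rw [zero_smul]; exact map_zero _⟩
    | tmul p q =>
      obtain ⟨a, rfl⟩ := he.exists_smul (hW.trans h) p
      obtain ⟨b, rfl⟩ := hf.exists_smul (hW.trans h) q
      refine ⟨a * b, ?_⟩
      rw [res_tmul, ← smul_tmul_smul]; rfl
    | add p q hp hq =>
      obtain ⟨a, ha⟩ := hp
      obtain ⟨b, hb⟩ := hq
      exact ⟨a + b, by rw [add_smul, ← ha, ← hb]; exact map_add _ _ _⟩

lemma tensorMap_comp {M M' M'' N N' N'' : S.Modules} (f : M ⟶ M') (f' : M' ⟶ M'') (g : N ⟶ N')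
    (g' : N' ⟶ N'') : tensorMap (f ≫ f') (g ≫ g') = tensorMap f g ≫ tensorMap f' g' := by
  refine Eq.trans ?_ ((PresheafOfModules.sheafification (𝟙 S.ringCatSheaf.obj)).map_comp _ _)
  exact congrArg (PresheafOfModules.sheafification (𝟙 S.ringCatSheaf.obj)).map
    (MonoidalCategory.tensorHom_comp_tensorHom
      (C := PresheafOfModules (S.presheaf ⋙ forget₂ CommRingCat RingCat))
      f.val g.val f'.val g'.val).symm

lemma tensorMap_id (M N : S.Modules) : tensorMap (𝟙 M) (𝟙 N) = 𝟙 (tensor M N) := by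
  refine Eq.trans ?_ ((PresheafOfModules.sheafification (𝟙 S.ringCatSheaf.obj)).map_id _)
  exact congrArg (PresheafOfModules.sheafification (𝟙 S.ringCatSheaf.obj)).map
    (MonoidalCategory.id_tensorHom_id
      (C := PresheafOfModules (S.presheaf ⋙ forget₂ CommRingCat RingCat)) M.val N.val)

end Tensor

/-! ## Cokernels -/

section Cokernel

variable {A B : S.Modules} (g : A ⟶ B)

lemma exists_app_eq_of_presheaf_cokernel_eq_zero {U : S.Opens} {b : Γ(B, U)}
    (h : (cokernel.π g.val).app (op U) (show B.val.obj (op U) from b) = 0) :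
    ∃ a, g.app U a = b := by
  have h1 := (ShortComplex.exact_cokernel g.val).map (PresheafOfModules.evaluation _ (op U))
  rw [ShortComplex.moduleCat_exact_iff] at h1
  exact h1 (show B.val.obj (op U) from b) h

lemma presheaf_cokernel_app_surjective (U : S.Opens) :
    Function.Surjective ((cokernel.π g.val).app (op U)) := by
  have : Epi ((PresheafOfModules.evaluation _ (op U)).map (cokernel.π g.val)) := inferInstance
  exact (ModuleCat.epi_iff_surjective _).mp this

/-- Sheafifying the presheaf cokernel computes the cokernel of sheaves. A retraction `d` of the
comparison map `c` is enough to deduce that sections of the cokernel lift locally and that sections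
dying in it come locally from the source. -/
lemma exists_toAssoc_presheaf_cokernel :
    ∃ (c : cokernel g ⟶ assocSheaf (cokernel g.val)) (d : assocSheaf (cokernel g.val) ⟶ cokernel g),
      c ≫ d = 𝟙 _ ∧ ∀ (U : S.Opens) (b : Γ(B, U)),
        c.app U ((cokernel.π g).app U b) = toAssoc (cokernel g.val) U
          ((cokernel.π g.val).app (op U) (show B.val.obj (op U) from b)) := by
  let adj := PresheafOfModules.sheafificationAdjunction (𝟙 S.ringCatSheaf.obj)
  let η : B ⟶ assocSheaf (cokernel g.val) :=
    ⟨cokernel.π g.val ≫ adj.unit.app (cokernel g.val)⟩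
  have hη : g ≫ η = 0 := by
    refine SheafOfModules.hom_ext ?_
    change g.val ≫ cokernel.π g.val ≫ _ = 0
    exact (Category.assoc _ _ _).symm.trans
      ((congrArg (· ≫ _) (cokernel.condition g.val)).trans zero_comp)
  have hπ : g.val ≫ (cokernel.π g).val = 0 :=
    congrArg SheafOfModules.Hom.val (cokernel.condition g)
  let d : assocSheaf (cokernel g.val) ⟶ cokernel g :=
    (adj.homEquiv (cokernel g.val) (cokernel g)).symm (cokernel.desc g.val (cokernel.π g).val hπ)
  refine ⟨cokernel.desc g η hη, d, ?_, fun U b => ?_⟩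
  · rw [← cancel_epi (cokernel.π g), cokernel.π_desc_assoc, Category.comp_id]
    have h1 : adj.unit.app (cokernel g.val) ≫ d.val = cokernel.desc g.val (cokernel.π g).val hπ :=
      (adj.homEquiv_unit ..).symm.trans (Equiv.apply_symm_apply _ _)
    refine SheafOfModules.hom_ext ?_
    change (cokernel.π g.val ≫ adj.unit.app (cokernel g.val)) ≫ d.val = _
    refine (Category.assoc _ _ _).trans ?_
    exact (congrArg (cokernel.π g.val ≫ ·) h1).trans (cokernel.π_desc _ _ _)
  · have h1 : cokernel.π g ≫ cokernel.desc g η hη = η := cokernel.π_desc _ _ _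
    exact congrArg (fun f : B ⟶ assocSheaf (cokernel g.val) => f.app U b) h1

lemma exists_cokernel_π_app_eq {U : S.Opens} (q : Γ(cokernel g, U)) {x : S} (hx : x ∈ U) :
    ∃ (V : S.Opens) (h : V ≤ U), x ∈ V ∧ ∃ b, (cokernel.π g).app V b = res (cokernel g) h q := by
  obtain ⟨c, d, hcd, hc⟩ := exists_toAssoc_presheaf_cokernel g
  have hcd' : ∀ (V : S.Opens) (q : Γ(cokernel g, V)), d.app V (c.app V q) = q := fun V q =>
    congrArg (fun f : cokernel g ⟶ cokernel g => f.app V q) hcd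
  obtain ⟨V, h, hxV, n, hn⟩ := exists_toAssoc_eq _ (c.app U q) hx
  obtain ⟨b, rfl⟩ := presheaf_cokernel_app_surjective g V n
  refine ⟨V, h, hxV, b, ?_⟩
  rw [← hcd' V (res _ h q), app_res, ← hn, ← hcd' V ((cokernel.π g).app V b)]
  exact congrArg (d.app V) (hc V b)

lemma exists_app_eq_of_cokernel_π_eq_zero {U : S.Opens} {b : Γ(B, U)}
    (hb : (cokernel.π g).app U b = 0) {x : S} (hx : x ∈ U) :
    ∃ (V : S.Opens) (h : V ≤ U), x ∈ V ∧ ∃ a, g.app V a = res B h b := by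
  obtain ⟨c, d, -, hc⟩ := exists_toAssoc_presheaf_cokernel g
  have h0 := hc U b
  rw [hb, map_zero] at h0
  obtain ⟨V, h, hxV, hV⟩ := exists_map_eq_zero_of_toAssoc_eq_zero _ h0.symm hx
  refine ⟨V, h, hxV, exists_app_eq_of_presheaf_cokernel_eq_zero g ?_⟩
  exact (PresheafOfModules.naturality_apply (cokernel.π g.val) (homOfLE h).op _).trans hV

lemma cokernel_π_app_app {U : S.Opens} (a : Γ(A, U)) : (cokernel.π g).app U (g.app U a) = 0 :=
  congrArg (fun f : A ⟶ cokernel g => f.app U a) (cokernel.condition g)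

end Cokernel

/-! ## Duals -/

section Dual

variable {M : S.Modules}

lemma resO_evalDual {U V : S.Opens} (h : V ≤ U) (φ : Γ(dual M, U)) (m : Γ(M, U)) :
    resO h (evalDual φ m) = evalDual (res (dual M) h φ) (res M h m) :=
  (show dualSections M U from φ).2 ⟨U, le_rfl⟩ ⟨V, h⟩ h m

lemma evalDual_smul {U : S.Opens} (a : Γ(S, U)) (φ : Γ(dual M, U)) (m : Γ(M, U)) :
    evalDual (a • φ) m = a * evalDual φ m :=
  congrArg (· * _) (resO_self le_rfl a)

lemma dual_ext {U : S.Opens} {φ ψ : Γ(dual M, U)}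
    (h : ∀ (V : S.Opens) (hV : V ≤ U) (m : Γ(M, V)),
      evalDual (res (dual M) hV φ) m = evalDual (res (dual M) hV ψ) m) : φ = ψ :=
  Subtype.ext (funext fun V => LinearMap.ext fun m => h V.1 V.2 m)

/-- A linear form `φ` on a free module of rank 1 equals `φ(e) μ`. -/
lemma isBasisOn_dual {U : S.Opens} {e : Γ(M, U)} (he : IsBasisOn M ![e]) {μ : Γ(dual M, U)}
    (hμ : evalDual μ e = 1) : IsBasisOn (dual M) ![μ] := by
  have hV : ∀ (V : S.Opens) (h : V ≤ U), evalDual (res _ h μ) (res _ h e) = 1 := fun V h => by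
    rw [← resO_evalDual, hμ, map_one]
  refine isBasisOn_singleton.mpr fun V h => ⟨fun a b hab => ?_, fun φ =>
    ⟨evalDual φ (res M h e), dual_ext fun W hW m => ?_⟩⟩
  · simpa only [evalDual_smul, hV, mul_one] using
      congrArg (fun φ : Γ(dual M, V) => evalDual φ (res M h e)) hab
  · obtain ⟨a, rfl⟩ := he.exists_smul (hW.trans h) m
    simp only [res_smul, res_res, evalDual_smul, map_smul, hV, resO_evalDual, smul_eq_mul,
      _root_.mul_one]

lemma IsBasisOn.exists_dual {U : S.Opens} {e : Γ(M, U)} (he : IsBasisOn M ![e]) :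
    ∃ μ : Γ(dual M, U), evalDual μ e = 1 := by
  choose φ hφ using fun V : {V : S.Opens // V ≤ U} =>
    (he.restrict_singleton V.2).exists_linearForm
  refine ⟨(⟨φ, fun V W h m => ?_⟩ : dualSections M U), ?_⟩
  · obtain ⟨a, rfl⟩ := he.exists_smul V.2 m
    rw [res_smul, res_res, (φ V).map_smul, (φ W).map_smul, hφ, hφ, smul_eq_mul, smul_eq_mul,
      _root_.mul_one, _root_.mul_one]
  · simpa only [res_self] using! hφ ⟨U, le_rfl⟩

end Dual

/-! ## The quotient of an algebra by its unit -/

namespace OAlgebra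

variable (C : OAlgebra S)

lemma res_one {U V : S.Opens} (h : V ≤ U) : res C.toModule h (C.one U) = C.one V := by
  refine (app_res C.unit h _).symm.trans (congrArg (C.unit.app V) ?_)
  exact map_one (resO h)

lemma unit_app {U : S.Opens} (a : Γ(S, U)) :
    C.unit.app U (show Γ(structureModule S, U) from a) = a • C.one U := by
  refine Eq.trans (congrArg (C.unit.app U) ?_) (Scheme.Modules.Hom.app_smul C.unit a _)
  exact (_root_.mul_one a).symm

lemma mul_one_left {U : S.Opens} (a : Γ(C.toModule, U)) : C.mul U (C.one U) a = a := C.one_mul U a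

lemma mul_one_right {U : S.Opens} (a : Γ(C.toModule, U)) : C.mul U a (C.one U) = a := C.mul_one U a

lemma bar_add {U : S.Opens} (a b : Γ(C.toModule, U)) : C.bar (a + b) = C.bar a + C.bar b :=
  map_add _ _ _

lemma bar_smul {U : S.Opens} (r : Γ(S, U)) (a : Γ(C.toModule, U)) : C.bar (r • a) = r • C.bar a :=
  Scheme.Modules.Hom.app_smul _ _ _

lemma res_bar {U V : S.Opens} (h : V ≤ U) (a : Γ(C.toModule, U)) :
    res C.quot h (C.bar a) = C.bar (res C.toModule h a) :=
  (app_res (cokernel.π C.unit) h a).symm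

lemma bar_one (U : S.Opens) : C.bar (C.one U) = 0 := cokernel_π_app_app C.unit _

variable {C}

/-- A multiple of `τ` vanishing in the quotient is locally a multiple of 1, so its coefficient is 0
by independence of `1, τ`; conversely the class of a local lift `a + b τ` is `b τ̄`. -/
lemma isBasisOn_bar {U : S.Opens} {τ : Γ(C.toModule, U)}
    (hτ : IsBasisOn C.toModule ![C.one U, τ]) : IsBasisOn C.quot ![C.bar τ] := by
  rw [isBasisOn_pair] at hτ
  refine isBasisOn_of_local (fun V h a ha => resO_ext_local fun x hx => ?_) fun V h m x hx => ?_
  · rw [res_bar, ← bar_smul] at ha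
    obtain ⟨W, hW, hxW, b, hb⟩ := exists_app_eq_of_cokernel_π_eq_zero C.unit ha hx
    refine ⟨W, hW, hxW, ?_⟩
    have h1 := hb.symm.trans (C.unit_app (show Γ(S, W) from b))
    rw [res_smul, res_res] at h1
    have h2 := @(hτ W (hW.trans h)).1 (0, resO hW a) (show Γ(S, W) from b, 0)
      (by simpa only [zero_smul, zero_add, add_zero, res_one] using h1)
    rw [map_zero]
    exact congrArg Prod.snd h2
  · obtain ⟨W, hW, hxW, c, hc⟩ := exists_cokernel_π_app_eq C.unit m hx
    refine ⟨W, hW, hxW, ?_⟩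
    obtain ⟨⟨a, b⟩, rfl⟩ := (hτ W (hW.trans h)).2 c
    refine ⟨b, hc.symm.trans ?_⟩
    change C.bar _ = _
    rw [bar_add, bar_smul, bar_smul, res_one, bar_one, smul_zero, zero_add, res_bar]

end OAlgebra

/-! ## Reduction modulo two -/

section ModTwo

variable {N : S.Modules}

lemma toModTwo_two_smul {U : S.Opens} (m : Γ(N, U)) :
    (toModTwo N).app U ((2 : Γ(S, U)) • m) = 0 := by
  refine Eq.trans (congrArg _ ?_) (cokernel_π_app_app ((2 : ℤ) • 𝟙 N) m)
  rw [two_smul, two_smul]; rfl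

/-- Halves are unique because 2 is regular, so local halves agree on overlaps and glue. -/
lemma exists_eq_two_mul_of_local (h2 : TwoIsRegular S) {U : S.Opens} {a : Γ(S, U)}
    (h : ∀ x ∈ U, ∃ (V : S.Opens) (hV : V ≤ U), x ∈ V ∧ ∃ b, resO hV a = 2 * b) :
    ∃ b, a = 2 * b := by
  choose W hW hx b hb using fun x : U => h x.1 x.2
  obtain ⟨t, ht, -⟩ := resO_glue W U hW (le_iSup_of_forall_mem hx) b fun x y => by
    refine sub_eq_zero.mp (h2 _ _ ?_)
    have h1 := congrArg (resO (inf_le_left : W x ⊓ W y ≤ W x)) (hb x)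
    have h2 := congrArg (resO (inf_le_right : W x ⊓ W y ≤ W y)) (hb y)
    rw [resO_resO, map_mul, map_ofNat] at h1 h2
    rw [mul_sub, ← h1, ← h2, sub_self]
  refine ⟨t, resO_ext W U hW (le_iSup_of_forall_mem hx) _ _ fun x => ?_⟩
  rw [hb, map_mul, map_ofNat, ht]

/-- The sheaf quotient `N/2N` only yields local divisibility by 2; uniqueness of halves makes it
divisibility over `U`. -/
lemma exists_eq_two_mul_of_toModTwo_eq (h2 : TwoIsRegular S) {U : S.Opens} {ν : Γ(N, U)}
    (hν : IsBasisOn N ![ν]) {p q : Γ(S, U)}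
    (h : (toModTwo N).app U (p • ν) = (toModTwo N).app U (q • ν)) : ∃ b, p - q = 2 * b := by
  refine exists_eq_two_mul_of_local h2 fun x hx => ?_
  have h' : (toModTwo N).app U ((p - q) • ν) = 0 := by
    rw [sub_smul, map_sub, h, sub_self]
  obtain ⟨V, hV, hxV, a, ha⟩ := exists_app_eq_of_cokernel_π_eq_zero ((2 : ℤ) • 𝟙 N) h' hx
  refine ⟨V, hV, hxV, ?_⟩
  obtain ⟨b, rfl⟩ := hν.exists_smul hV a
  refine ⟨b, hν.smul_injective hV ?_⟩
  rw [← res_smul, ← ha, two_smul, two_mul, add_smul]; rfl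

lemma toModTwo_comp_modTwoMap {N' : S.Modules} (f : N ⟶ N') :
    toModTwo N ≫ modTwoMap f = f ≫ toModTwo N' :=
  cokernel.π_desc _ _ _

lemma modTwoMap_toModTwo {N' : S.Modules} (f : N ⟶ N') {U : S.Opens} (m : Γ(N, U)) :
    (modTwoMap f).app U ((toModTwo N).app U m) = (toModTwo N').app U (f.app U m) :=
  congrArg (fun g : N ⟶ modTwo N' => g.app U m) (toModTwo_comp_modTwoMap f)

lemma modTwoMap_comp {N' N'' : S.Modules} (f : N ⟶ N') (g : N' ⟶ N'') :
    modTwoMap (f ≫ g) = modTwoMap f ≫ modTwoMap g := by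
  refine (cancel_epi (cokernel.π ((2 : ℤ) • 𝟙 N))).mp ?_
  change toModTwo N ≫ _ = toModTwo N ≫ _
  rw [toModTwo_comp_modTwoMap, ← Category.assoc, toModTwo_comp_modTwoMap, Category.assoc,
    Category.assoc, toModTwo_comp_modTwoMap]

lemma modTwoMap_id (N : S.Modules) : modTwoMap (𝟙 N) = 𝟙 (modTwo N) := by
  refine (cancel_epi (cokernel.π ((2 : ℤ) • 𝟙 N))).mp ?_
  simp [modTwoMap, modTwo]

end ModTwo

/-! ## Glueing morphisms -/

section Glue

variable {M N : S.Modules} {ι : Type u} {U : ι → S.Opens}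

/-- The morphism sends `c e_i` to `c f_i` locally. Matching transition coefficients make these local
values independent of `i`, so they glue. -/
lemma exists_hom_of_bases (hU : iSup U = ⊤) {e : ∀ i, Γ(M, U i)} (f : ∀ i, Γ(N, U i))
    (he : ∀ i, IsBasisOn M ![e i])
    (hef : ∀ i j (ε : Γ(S, U i ⊓ U j)), res M inf_le_right (e j) = ε • res M inf_le_left (e i) →
      res N inf_le_right (f j) = ε • res N inf_le_left (f i)) :
    ∃ φ : M ⟶ N, ∀ i, φ.app (U i) (e i) = f i := by
  have hcov : ∀ V : S.Opens, V ≤ ⨆ i, V ⊓ U i := fun V => by rw [← inf_iSup_eq, hU, inf_top_eq]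
  have hef' : ∀ i j (W : S.Opens) (hi : W ≤ U i) (hj : W ≤ U j) (c : Γ(S, W)),
      res M hj (e j) = c • res M hi (e i) → res N hj (f j) = c • res N hi (f i) := by
    intro i j W hi hj c hc
    obtain ⟨ε, hε⟩ := (he i).exists_smul (inf_le_left : U i ⊓ U j ≤ U i) (res M inf_le_right (e j))
    have h1 := congrArg (res N (le_inf hi hj)) (hef i j ε hε)
    have h2 := congrArg (res M (le_inf hi hj)) hε
    simp only [res_smul, res_res] at h1 h2
    rw [h1, (he i).smul_injective hi (hc.symm.trans h2)]
  -- The value at `m` is characterised by all its local coordinates, on every open contained in some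
  -- `U_i`, and not only by those on `V ⊓ U_i`.
  have key : ∀ (V : S.Opens) (m : Γ(M, V)), ∃ n : Γ(N, V), ∀ i (W : S.Opens) (hW : W ≤ V)
      (hi : W ≤ U i) (c : Γ(S, W)), res M hW m = c • res M hi (e i) →
        res N hW n = c • res N hi (f i) := by
    intro V m
    choose c hc using fun i => (he i).exists_smul (inf_le_right : V ⊓ U i ≤ U i) (res M inf_le_left m)
    obtain ⟨n, hn, -⟩ := res_glue N (fun i => V ⊓ U i) V (fun i => inf_le_left) (hcov V)
      (fun i => c i • res N inf_le_right (f i)) fun i j => by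
        have h3 := congrArg (res M (inf_le_left : (V ⊓ U i) ⊓ (V ⊓ U j) ≤ V ⊓ U i)) (hc i)
        have h4 := congrArg (res M (inf_le_right : (V ⊓ U i) ⊓ (V ⊓ U j) ≤ V ⊓ U j)) (hc j)
        obtain ⟨ε, hε⟩ := (he i).exists_smul (inf_le_left.trans inf_le_right)
          (res M ((inf_le_right : (V ⊓ U i) ⊓ (V ⊓ U j) ≤ V ⊓ U j).trans inf_le_right) (e j))
        simp only [res_smul, res_res] at h3 h4 ⊢
        rw [hef' i j _ _ _ ε hε, smul_smul]
        rw [hε, smul_smul, h3] at h4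
        rw [(he i).smul_injective _ h4]
    refine ⟨n, fun i W hW hi a ha => ?_⟩
    have h1 := congrArg (res N (le_inf hW hi)) (hn i)
    have h2 := congrArg (res M (le_inf hW hi)) (hc i)
    simp only [res_smul, res_res] at h1 h2
    rw [h1]
    rw [ha] at h2
    rw [(he i).smul_injective _ h2]
  choose g hg using key
  -- This characterisation is unique, so additivity, linearity and naturality reduce to identities
  -- between coefficients.
  have hg' : ∀ (V : S.Opens) (m : Γ(M, V)) (n : Γ(N, V)), (∀ i (W : S.Opens) (hW : W ≤ V)
      (hi : W ≤ U i) (c : Γ(S, W)), res M hW m = c • res M hi (e i) →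
        res N hW n = c • res N hi (f i)) → g V m = n := fun V m n hn =>
    res_ext_cover hU fun i W hW hi => by
      obtain ⟨c, hc⟩ := (he i).exists_smul hi (res M hW m)
      rw [hg V m i W hW hi c hc, hn i W hW hi c hc]
  have hadd : ∀ (V : S.Opens) (m m' : Γ(M, V)), g V (m + m') = g V m + g V m' := fun V m m' =>
    hg' _ _ _ fun i W hW hi c hc => by
      obtain ⟨a, ha⟩ := (he i).exists_smul hi (res M hW m)
      obtain ⟨b, hb⟩ := (he i).exists_smul hi (res M hW m')
      rw [map_add, ha, hb, ← add_smul] at hc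
      rw [map_add, hg V m i W hW hi a ha, hg V m' i W hW hi b hb, ← add_smul,
        (he i).smul_injective _ hc]
  have hsmul : ∀ (V : S.Opens) (r : Γ(S, V)) (m : Γ(M, V)), g V (r • m) = r • g V m :=
    fun V r m => hg' _ _ _ fun i W hW hi c hc => by
      obtain ⟨a, ha⟩ := (he i).exists_smul hi (res M hW m)
      rw [res_smul, ha, smul_smul] at hc
      rw [res_smul, hg V m i W hW hi a ha, smul_smul, (he i).smul_injective _ hc]
  have hres : ∀ (V V' : S.Opens) (h : V' ≤ V) (m : Γ(M, V)), g V' (res M h m) = res N h (g V m) :=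
    fun V V' h m => hg' _ _ _ fun i W hW hi c hc => by
      rw [res_res] at hc ⊢
      exact hg V m i W _ hi c hc
  refine ⟨⟨PresheafOfModules.homMk
    { app := fun V => AddCommGrpCat.ofHom (AddMonoidHom.mk' (g V.unop) (hadd V.unop))
      naturality := fun V V' h => ?_ } fun V r m => hsmul V.unop r m⟩, fun i => ?_⟩
  · ext m
    exact hres V.unop V'.unop (leOfHom h.unop) m
  · refine hg' _ _ _ fun j W hW hi c hc => ?_
    exact hef' j i W hi hW c hc

/-- Transition coefficients are unique in both modules, so the compatibility also holds from `f` to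
`e` and gives an inverse; an endomorphism fixing local bases is the identity. -/
lemma exists_iso_of_bases (hU : iSup U = ⊤) {e : ∀ i, Γ(M, U i)} {f : ∀ i, Γ(N, U i)}
    (he : ∀ i, IsBasisOn M ![e i]) (hf : ∀ i, IsBasisOn N ![f i])
    (hef : ∀ i j (ε : Γ(S, U i ⊓ U j)), res M inf_le_right (e j) = ε • res M inf_le_left (e i) →
      res N inf_le_right (f j) = ε • res N inf_le_left (f i)) :
    ∃ φ : M ≅ N, ∀ i, φ.hom.app (U i) (e i) = f i := by
  obtain ⟨φ, hφ⟩ := exists_hom_of_bases hU f he hef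
  obtain ⟨ψ, hψ⟩ := exists_hom_of_bases hU e hf fun i j ε hε => by
    obtain ⟨c, hc⟩ := (he i).exists_smul (inf_le_left : U i ⊓ U j ≤ U i) (res M inf_le_right (e j))
    rw [hc, (hf i).smul_injective _ (hε.symm.trans (hef i j c hc))]
  have hid : ∀ {L : S.Modules} {b : ∀ i, Γ(L, U i)} (_ : ∀ i, IsBasisOn L ![b i]) (χ : L ⟶ L),
      (∀ i, χ.app (U i) (b i) = b i) → χ = 𝟙 L := by
    intro L b hb χ hχ
    ext V m
    refine res_ext_cover hU fun i W hW hi => ?_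
    obtain ⟨c, hc⟩ := (hb i).exists_smul hi (res L hW m)
    refine (app_res χ hW m).symm.trans ?_
    change _ = res L hW m
    rw [hc, Scheme.Modules.Hom.app_smul, app_res, hχ]
  refine ⟨⟨φ, ψ, hid he _ fun i => ?_, hid hf _ fun i => ?_⟩, hφ⟩
  · exact (congrArg (ψ.app (U i)) (hφ i)).trans (hψ i)
  · exact (congrArg (φ.app (U i)) (hψ i)).trans (hφ i)

end Glue

/-! ## Local generators of quadratic algebras -/

section ChangeOfBasis

variable {M : S.Modules} {U : S.Opens} {e f : Γ(M, U)}

lemma IsBasisOn.swap (h : IsBasisOn M ![e, f]) : IsBasisOn M ![f, e] := by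
  rw [isBasisOn_pair] at h ⊢
  intro V hV
  convert! (h V hV).comp (Equiv.prodComm _ _).bijective using 2 with a
  exact add_comm _ _

lemma IsBasisOn.coeff_injective (h : IsBasisOn M ![e, f]) {V : S.Opens} (hV : V ≤ U)
    {a b a' b' : Γ(S, V)}
    (hab : a • res M hV e + b • res M hV f = a' • res M hV e + b' • res M hV f) :
    a = a' ∧ b = b' :=
  Prod.ext_iff.mp (@(isBasisOn_pair.mp h V hV).1 (a, b) (a', b') hab)

lemma IsBasisOn.exists_coeff (h : IsBasisOn M ![e, f]) {V : S.Opens} (hV : V ≤ U) (m : Γ(M, V)) :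
    ∃ a b : Γ(S, V), m = a • res M hV e + b • res M hV f := by
  obtain ⟨⟨a, b⟩, hab⟩ := (isBasisOn_pair.mp h V hV).2 m
  exact ⟨a, b, hab.symm⟩

lemma IsBasisOn.restrict_pair (h : IsBasisOn M ![e, f]) {V : S.Opens} (hV : V ≤ U) :
    IsBasisOn M ![res M hV e, res M hV f] := by
  convert! h.restrict hV using 1
  ext i; fin_cases i <;> rfl

lemma IsBasisOn.replace_left (h : IsBasisOn M ![e, f]) {a b : Γ(S, U)} (ha : IsUnit a) :
    IsBasisOn M ![a • e + b • f, f] := by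
  refine isBasisOn_pair.mpr fun V hV => ⟨fun x y hxy => ?_, fun m => ?_⟩
  · simp only [map_add, res_smul, smul_add, smul_smul, add_assoc, ← add_smul] at hxy
    obtain ⟨h1, h2⟩ := h.coeff_injective hV hxy
    have h3 := (ha.map (resO hV)).mul_right_cancel h1
    exact Prod.ext h3 (by rw [h3] at h2; exact add_left_cancel h2)
  · obtain ⟨x, y, rfl⟩ := h.exists_coeff hV m
    obtain ⟨c, hc⟩ := (ha.map (resO hV)).exists_left_inv
    refine ⟨(x * c, y - x * c * resO hV b), ?_⟩
    simp only [map_add, res_smul, smul_add, smul_smul, mul_assoc, hc, mul_one, sub_smul]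
    abel

end ChangeOfBasis

namespace OAlgebra

variable {C : OAlgebra S}

lemma exists_isGenerator {U : S.Opens} {τ : Γ(C.toModule, U)}
    (h : IsBasisOn C.toModule ![C.one U, τ]) : ∃ r s, C.IsGenerator τ r s := by
  obtain ⟨a, b, hab⟩ := h.exists_coeff le_rfl (C.mul U τ τ)
  refine ⟨-b, -a, h, ?_⟩
  simp only [hab, res_self, neg_smul]
  abel

/-- Locally, the unit of a quadratic algebra is part of a basis. -/
lemma IsQuadratic.exists_isGenerator (hC : C.IsQuadratic) (x : S) :
    ∃ (U : S.Opens) (_ : x ∈ U) (τ : Γ(C.toModule, U)) (r s : Γ(S, U)), C.IsGenerator τ r s := by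
  obtain ⟨U, hxU, e, he⟩ := hC x
  obtain ⟨e₀, e₁, rfl⟩ : ∃ e₀ e₁, e = ![e₀, e₁] :=
    ⟨e 0, e 1, by ext i; fin_cases i <;> rfl⟩
  obtain ⟨a, b, hab⟩ := he.exists_coeff le_rfl (C.one U)
  obtain ⟨α, α', hα⟩ := he.exists_coeff le_rfl (C.mul U e₀ e₀)
  obtain ⟨β, β', hβ⟩ := he.exists_coeff le_rfl (C.mul U e₁ e₀)
  simp only [res_self] at hab hα hβ
  -- Compare the coefficients of `e₀` in `1 · e₀ = e₀`, where `1 = a e₀ + b e₁`. Hence `a` and `b`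
  -- generate the unit ideal, and one of them is invertible near `x`.
  have hone : a * α + b * β = 1 := by
    have h1 := C.mul_one_left e₀
    rw [hab, map_add, map_smul, map_smul, LinearMap.add_apply, LinearMap.smul_apply,
      LinearMap.smul_apply, hα, hβ] at h1
    refine (he.coeff_injective le_rfl (b := a * α' + b * β') (b' := 0) ?_).1
    simp only [res_self, one_smul, zero_smul, add_zero]
    refine Eq.trans ?_ h1
    simp only [add_smul, mul_smul, smul_add]
    abel
  have hx : x ∈ S.basicOpen (a * α + b * β) := by
    rw [hone, Scheme.basicOpen_of_isUnit _ isUnit_one]; exact hxU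
  have key : ∀ {e f : Γ(C.toModule, U)} {a b : Γ(S, U)}, IsBasisOn C.toModule ![e, f] →
      C.one U = a • e + b • f → x ∈ S.basicOpen a →
      ∃ (U : S.Opens) (_ : x ∈ U) (τ : Γ(C.toModule, U)) (r s : Γ(S, U)), C.IsGenerator τ r s := by
    intro e f a b hef h1 hxa
    have hu : IsUnit (resO (S.basicOpen_le a) a) :=
      RingedSpace.isUnit_res_basicOpen S.toRingedSpace a
    have hb := (hef.restrict_pair (S.basicOpen_le a)).replace_left
      (b := resO (S.basicOpen_le a) b) hu
    rw [← res_smul, ← res_smul, ← map_add, ← h1, res_one] at hb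
    exact ⟨_, hxa, _, OAlgebra.exists_isGenerator hb⟩
  -- Where `a` is invertible, 1 can replace `e₀`; where `b` is, it can replace `e₁`.
  rcases Scheme.basicOpen_add_le _ _ _ hx with h | h
  · exact key he hab ((Scheme.basicOpen_mul _ _ _).le.trans inf_le_left h)
  · exact key he.swap (hab.trans (add_comm _ _)) ((Scheme.basicOpen_mul _ _ _).le.trans inf_le_left h)

lemma IsDualBar.unique {U : S.Opens} {τ : Γ(C.toModule, U)}
    (hτ : IsBasisOn C.toModule ![C.one U, τ]) {μ μ' : Γ(dual C.quot, U)} (hμ : C.IsDualBar τ μ)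
    (hμ' : C.IsDualBar τ μ') : μ = μ' := by
  obtain ⟨a, ha⟩ := (isBasisOn_dual (isBasisOn_bar hτ) hμ).exists_smul le_rfl μ'
  rw [res_self] at ha
  rw [IsDualBar, ha, evalDual_smul, hμ, _root_.mul_one] at hμ'
  rw [ha, hμ', one_smul]

end OAlgebra

lemma IsBasisOn.map_iso {M N : S.Modules} (f : M ≅ N) {U : S.Opens} {e : Γ(M, U)}
    (he : IsBasisOn M ![e]) : IsBasisOn N ![f.hom.app U e] := by
  have hinv : ∀ {V : S.Opens} (m : Γ(M, V)), f.inv.app V (f.hom.app V m) = m := fun {V} m =>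
    congrArg (fun g : M ⟶ M => g.app V m) f.hom_inv_id
  have hhom : ∀ {V : S.Opens} (n : Γ(N, V)), f.hom.app V (f.inv.app V n) = n := fun {V} n =>
    congrArg (fun g : N ⟶ N => g.app V n) f.inv_hom_id
  refine isBasisOn_singleton.mpr fun V hV => ⟨fun a b hab => he.smul_injective hV ?_, fun n => ?_⟩
  · simp only [← app_res, ← Scheme.Modules.Hom.app_smul] at hab
    rw [← hinv (a • res M hV e), hab, hinv]
  · obtain ⟨a, ha⟩ := he.exists_smul hV (f.inv.app V n)
    refine ⟨a, ?_⟩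
    rw [← hhom n, ha, Scheme.Modules.Hom.app_smul, app_res]

lemma IsValid.exists_isAdaptedCover (h2 : TwoIsRegular S) {N : S.Modules}
    {Δ : Γ(tensor N N, (⊤ : S.Opens))} {P : Γ(modTwo N, (⊤ : S.Opens))} (h : IsValid N Δ P) :
    ∃ (ι : Type u) (U : ι → S.Opens), IsAdaptedCover N Δ P U := by
  obtain ⟨C, f, hC, Δ₀, P₀, hΔ₀, hP₀, hf⟩ := h
  have key : ∀ x : S, ∃ (U : S.Opens) (_ : x ∈ U) (ν : Γ(N, U)) (r s : Γ(S, U)),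
      IsBasisOn N ![ν] ∧ res _ (le_top : U ≤ ⊤) Δ = (r ^ 2 - 4 * s) • tmul ν ν ∧
      res _ (le_top : U ≤ ⊤) P = (toModTwo N).app U (r • ν) := by
    intro x
    obtain ⟨U, hxU, τ, r, s, hτ⟩ := hC.exists_isGenerator x
    obtain ⟨μ, hμ, hΔ⟩ := hΔ₀ U τ r s hτ
    obtain ⟨μ', hμ', hP⟩ := hP₀ U τ r s hτ
    -- Discriminant and parity each provide a dual basis of `τ̄`; there is only one.
    obtain rfl := OAlgebra.IsDualBar.unique hτ.basis hμ hμ'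
    refine ⟨U, hxU, f.hom.app U μ, r, s,
      (isBasisOn_dual (OAlgebra.isBasisOn_bar hτ.basis) hμ).map_iso f, ?_, ?_⟩
    · rw [← hf.disc, ← app_res, hΔ, Scheme.Modules.Hom.app_smul, tensorMap_tmul]
    · rw [← hf.parity, ← app_res, hP, modTwoMap_toModTwo, Scheme.Modules.Hom.app_smul]
  choose U hU ν r s hν hΔ hP using key
  refine ⟨S, U, eq_top_iff.mpr fun x _ => TopologicalSpace.Opens.mem_iSup.mpr ⟨x, hU x⟩,
    fun x => ⟨ν x, hν x⟩, fun x => ⟨r x • ν x, (hP x).symm⟩, fun x t ht => ?_⟩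
  obtain ⟨p, rfl⟩ := (hν x).exists_smul le_rfl t
  simp only [res_self] at ht ⊢
  obtain ⟨b, hb⟩ := exists_eq_two_mul_of_toModTwo_eq h2 (hν x) (Eq.trans ht (hP x))
  -- From `p = r + 2b` follows `r² - 4s = p² + 4(-s - r b - b²)`.
  refine ⟨(-(s x) - r x * b - b ^ 2) • tmul (ν x) (ν x), ?_⟩
  rw [hΔ, smul_tmul_smul, smul_smul, ← add_smul, eq_add_of_sub_eq hb]
  congr 1
  ring

/-! ## Comparison of generators -/

lemma TwoIsRegular.eq_of_two_mul_eq (h2 : TwoIsRegular S) {U : S.Opens} {a b : Γ(S, U)}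
    (h : 2 * a = 2 * b) : a = b :=
  sub_eq_zero.mp (h2 U _ (by rw [mul_sub, h, sub_self]))

namespace OAlgebra

variable {C : OAlgebra S}

lemma IsGenerator.restrict {U V : S.Opens} {τ : Γ(C.toModule, U)} {r s : Γ(S, U)}
    (h : C.IsGenerator τ r s) (hV : V ≤ U) :
    C.IsGenerator (res C.toModule hV τ) (resO hV r) (resO hV s) where
  basis := by
    have := h.basis.restrict_pair hV
    rwa [res_one] at this
  eqn := by
    have := congrArg (res C.toModule hV) h.eqn
    simpa only [map_add, map_zero, res_mul, res_smul, res_one] using this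

lemma IsDualBar.restrict {U V : S.Opens} {τ : Γ(C.toModule, U)} {μ : Γ(dual C.quot, U)}
    (h : C.IsDualBar τ μ) (hV : V ≤ U) : C.IsDualBar (res C.toModule hV τ) (res _ hV μ) := by
  rw [IsDualBar, ← res_bar, ← resO_evalDual, h, map_one]

section Compare

variable {U : S.Opens} {τ ω : Γ(C.toModule, U)} {μ κ : Γ(dual C.quot, U)}

lemma IsDualBar.eq_smul (hω : IsBasisOn C.toModule ![C.one U, ω])
    (hμ : C.IsDualBar τ μ) (hκ : C.IsDualBar ω κ) {x y : Γ(S, U)}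
    (h : τ = x • C.one U + y • ω) : κ = y • μ := by
  obtain ⟨a, ha⟩ := (isBasisOn_dual (isBasisOn_bar hω) hκ).exists_smul le_rfl μ
  rw [res_self] at ha
  rw [IsDualBar, h, bar_add, bar_smul, bar_smul, bar_one, smul_zero, zero_add, ha, evalDual_smul,
    map_smul, hκ, smul_eq_mul, _root_.mul_one] at hμ
  rw [ha, smul_smul, mul_comm, hμ, one_smul]

/-- Substituting `τ = x + y ω` into its quadratic equation and comparing coefficients in the basis
`(1, ω)` gives both formulas. They show that `r τ̄^∨` modulo 2 and `(r² - 4s) τ̄^∨ ⊗ τ̄^∨` do not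
depend on the generator. -/
lemma IsGenerator.exists_compare {r s p q : Γ(S, U)} (hτ : C.IsGenerator τ r s)
    (hω : C.IsGenerator ω p q) : ∃ x y : Γ(S, U), τ = x • C.one U + y • ω ∧ r = y * p - 2 * x ∧
      r ^ 2 - 4 * s = y ^ 2 * (p ^ 2 - 4 * q) := by
  obtain ⟨x, y, hxy⟩ := hω.basis.exists_coeff le_rfl τ
  obtain ⟨x', y', hxy'⟩ := hτ.basis.exists_coeff le_rfl ω
  simp only [res_self] at hxy hxy'
  -- Expressing `τ` through `ω` and back shows that `y` is a unit; this allows cancelling it in the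
  -- coefficient of `ω` below.
  have hyy : y * y' = 1 := by
    refine (hτ.basis.coeff_injective le_rfl (a := x + y * x') (a' := 0) ?_).2
    simp only [res_self, one_smul, zero_smul, zero_add]
    conv_rhs => rw [hxy, hxy']
    simp only [add_smul, smul_add, mul_smul]
    abel
  have hω2 : C.mul U ω ω = -(p • ω) - q • C.one U := by
    rw [← sub_eq_zero, ← hω.eqn]
    abel
  have h1 := hτ.eqn
  rw [hxy] at h1
  simp only [map_add, map_smul, LinearMap.add_apply, LinearMap.smul_apply, mul_one_left,
    mul_one_right, hω2] at h1
  obtain ⟨h3, h4⟩ := hω.basis.coeff_injective le_rfl (a := x * x - y ^ 2 * q + r * x + s) (a' := 0)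
    (b := 2 * (x * y) - y ^ 2 * p + r * y) (b' := 0) (by
      simp only [res_self, zero_smul, add_zero]
      rw [← h1]
      module)
  have hr : r = y * p - 2 * x := by
    linear_combination y' * h4 + (y * p - 2 * x - r) * hyy
  refine ⟨x, y, hxy, hr, ?_⟩
  linear_combination -4 * h3 + (r + 2 * x + y * p) * hr

end Compare

section OfCover

variable {ι : Type*} {U : ι → S.Opens} {ω : ∀ i, Γ(C.toModule, U i)} {p q : ∀ i, Γ(S, U i)}
  {μ : ∀ i, Γ(dual C.quot, U i)}

/-- Over an open inside `U_i`, an arbitrary `τ` is compared with `ω_i`: the coefficient gains `y²`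
while `τ̄^∨ ⊗ τ̄^∨` loses it. -/
lemma isWoodDiscriminant_of_cover (hU : iSup U = ⊤) (hω : ∀ i, C.IsGenerator (ω i) (p i) (q i))
    (hμ : ∀ i, C.IsDualBar (ω i) (μ i))
    {Δ : Γ(tensor (dual C.quot) (dual C.quot), (⊤ : S.Opens))}
    (hΔ : ∀ i, res _ (le_top : U i ≤ ⊤) Δ = (p i ^ 2 - 4 * q i) • tmul (μ i) (μ i)) :
    C.IsWoodDiscriminant Δ := by
  intro V τ r s hτ
  obtain ⟨κ, hκ⟩ := (isBasisOn_bar hτ.basis).exists_dual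
  refine ⟨κ, hκ, res_ext_cover hU fun i W hW hi => ?_⟩
  obtain ⟨x, y, hxy, -, h⟩ := (hτ.restrict hW).exists_compare ((hω i).restrict hi)
  have h1 := IsDualBar.eq_smul ((hω i).restrict hi).basis (IsDualBar.restrict hκ hW)
    ((hμ i).restrict hi) hxy
  have h2 := congrArg (res _ hi) (hΔ i)
  simp only [res_res, res_smul, res_tmul, map_sub, map_pow, map_mul, map_ofNat] at h2 ⊢
  rw [h2, h, h1, smul_tmul_smul, smul_smul]
  congr 1
  ring

/-- Here `r τ̄^∨` and `p_i ω̄_i^∨` differ by `2x τ̄^∨`, which dies modulo 2. -/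
lemma isParity_of_cover (hU : iSup U = ⊤) (hω : ∀ i, C.IsGenerator (ω i) (p i) (q i))
    (hμ : ∀ i, C.IsDualBar (ω i) (μ i)) {P : Γ(modTwo (dual C.quot), (⊤ : S.Opens))}
    (hP : ∀ i, res _ (le_top : U i ≤ ⊤) P = (toModTwo (dual C.quot)).app (U i) (p i • μ i)) :
    C.IsParity P := by
  intro V τ r s hτ
  obtain ⟨κ, hκ⟩ := (isBasisOn_bar hτ.basis).exists_dual
  refine ⟨κ, hκ, res_ext_cover hU fun i W hW hi => ?_⟩
  obtain ⟨x, y, hxy, h, -⟩ := (hτ.restrict hW).exists_compare ((hω i).restrict hi)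
  have h1 := IsDualBar.eq_smul ((hω i).restrict hi).basis (IsDualBar.restrict hκ hW)
    ((hμ i).restrict hi) hxy
  have h2 := congrArg (res _ hi) (hP i)
  rw [res_res, ← app_res, res_smul, h1] at h2
  rw [res_res, h2, ← app_res, res_smul, h, sub_smul, map_sub, mul_smul 2 x, toModTwo_two_smul,
    sub_zero, smul_smul, mul_comm]

end OfCover

end OAlgebra

/-! ### The type of a glued algebra -/

section Glueing

variable {N : S.Modules} {ι : Type u} {U : ι → S.Opens} {ν : ∀ i, Γ(N, U i)}
  {p a : ∀ i, Γ(S, U i)} {Ω : OAlgebra S} {ω : ∀ i, Γ(Ω.toModule, U i)}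

lemma IsGlueing.isQuadratic (h : IsGlueing ν p a Ω ω) (hU : iSup U = ⊤) : Ω.IsQuadratic := by
  intro x
  obtain ⟨i, hi⟩ := TopologicalSpace.Opens.mem_iSup.mp (hU ▸ trivial : x ∈ iSup U)
  exact ⟨U i, hi, _, (h.generator i).basis⟩

/-- From `ω_i = ε ω_j + b` the dual bases satisfy `μ_j = ε μ_i`, the same rule as `ν_j = ε ν_i`. -/
lemma IsGlueing.exists_iso (h : IsGlueing ν p a Ω ω) (hU : iSup U = ⊤)
    (hν : ∀ i, IsBasisOn N ![ν i]) :
    ∃ (f : dual Ω.quot ≅ N) (μ : ∀ i, Γ(dual Ω.quot, U i)),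
      (∀ i, Ω.IsDualBar (ω i) (μ i)) ∧ ∀ i, f.hom.app (U i) (μ i) = ν i := by
  choose μ hμ using fun i => (OAlgebra.isBasisOn_bar (h.generator i).basis).exists_dual
  obtain ⟨f, hf⟩ := exists_iso_of_bases hU
    (fun i => isBasisOn_dual (OAlgebra.isBasisOn_bar (h.generator i).basis) (hμ i)) hν
    fun i j c hc => by
      obtain ⟨ε, b, hε, -, hω⟩ := h.transition i j
      have h1 := OAlgebra.IsDualBar.eq_smul ((h.generator j).restrict inf_le_right).basis
        (OAlgebra.IsDualBar.restrict (hμ i) inf_le_left)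
        (OAlgebra.IsDualBar.restrict (hμ j) inf_le_right) (hω.trans (add_comm _ _))
      rw [hε, (isBasisOn_dual (OAlgebra.isBasisOn_bar (h.generator i).basis)
        (hμ i)).smul_injective _ (hc.symm.trans h1)]
  exact ⟨f, μ, hμ, hf⟩

/-- The global discriminant and parity of `Ω` are obtained by transporting `Δ` and `P` along the
inverse of `f`, then recognised on the covering. -/
lemma IsGlueing.hasTypeVia (h : IsGlueing ν p a Ω ω) (hU : iSup U = ⊤)
    {f : dual Ω.quot ≅ N} {μ : ∀ i, Γ(dual Ω.quot, U i)} (hμ : ∀ i, Ω.IsDualBar (ω i) (μ i))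
    (hf : ∀ i, f.hom.app (U i) (μ i) = ν i)
    {Δ : Γ(tensor N N, (⊤ : S.Opens))} {P : Γ(modTwo N, (⊤ : S.Opens))}
    (hΔ : ∀ i, res _ (le_top : U i ≤ ⊤) Δ = (p i ^ 2 + 4 * a i) • tmul (ν i) (ν i))
    (hP : ∀ i, res _ (le_top : U i ≤ ⊤) P = (toModTwo N).app (U i) (p i • ν i)) :
    HasTypeVia Ω f Δ P := by
  have hinv : ∀ i, f.inv.app (U i) (ν i) = μ i := fun i => by
    rw [← hf i]
    exact congrArg (fun g : dual Ω.quot ⟶ dual Ω.quot => g.app (U i) (μ i)) f.hom_inv_id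
  refine ⟨(tensorMap f.inv f.inv).app ⊤ Δ, (modTwoMap f.inv).app ⊤ P,
    OAlgebra.isWoodDiscriminant_of_cover hU h.generator hμ fun i => ?_,
    OAlgebra.isParity_of_cover hU h.generator hμ fun i => ?_, ?_, ?_⟩
  · rw [← app_res, hΔ, Scheme.Modules.Hom.app_smul, tensorMap_tmul, hinv, mul_neg, sub_neg_eq_add]
  · rw [← app_res, hP, modTwoMap_toModTwo, Scheme.Modules.Hom.app_smul, hinv]
  · have h1 : tensorMap f.inv f.inv ≫ tensorMap f.hom f.hom = 𝟙 _ := by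
      rw [← tensorMap_comp, f.inv_hom_id, tensorMap_id]
    exact congrArg (fun g : tensor N N ⟶ tensor N N => g.app ⊤ Δ) h1
  · have h1 : modTwoMap f.inv ≫ modTwoMap f.hom = 𝟙 _ := by
      rw [← modTwoMap_comp, f.inv_hom_id, modTwoMap_id]
    exact congrArg (fun g : modTwo N ⟶ modTwo N => g.app ⊤ P) h1

end Glueing

/-! ## The glued algebra -/

/-- Families of sections `(x_i, y_i)` over `V ∩ U_i`, thought of as `x_i + y_i ω_i`. -/
def PairFamily {ι : Type u} (U : ι → S.Opens) (V : S.Opens) : Type u :=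
  ∀ i, Γ(S, V ⊓ U i) × Γ(S, V ⊓ U i)

namespace PairFamily

variable {ι : Type u} {U : ι → S.Opens} {V : S.Opens}

instance : AddCommGroup (PairFamily U V) :=
  inferInstanceAs (AddCommGroup (∀ i, Γ(S, V ⊓ U i) × Γ(S, V ⊓ U i)))

instance : Module Γ(S, V) (PairFamily U V) :=
  @Pi.module ι (fun i => Γ(S, V ⊓ U i) × Γ(S, V ⊓ U i)) Γ(S, V) _ _
    (fun i => Module.compHom (Γ(S, V ⊓ U i) × Γ(S, V ⊓ U i))
      (resO (inf_le_left : V ⊓ U i ≤ V)))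

/-- The constant coefficient of a family over `W ≤ V ∩ U_i`. -/
def fst (s : PairFamily U V) (i : ι) {W : S.Opens} (hV : W ≤ V) (hi : W ≤ U i) : Γ(S, W) :=
  resO (le_inf hV hi) (s i).1

/-- The coefficient of `ω_i` of a family over `W ≤ V ∩ U_i`. -/
def snd (s : PairFamily U V) (i : ι) {W : S.Opens} (hV : W ≤ V) (hi : W ≤ U i) : Γ(S, W) :=
  resO (le_inf hV hi) (s i).2

/-- The restriction of a family to a smaller open. -/
def restrict {V' : S.Opens} (h : V' ≤ V) : PairFamily U V →+ PairFamily U V' where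
  toFun s i := (s.fst i (inf_le_left.trans h) inf_le_right,
    s.snd i (inf_le_left.trans h) inf_le_right)
  map_zero' := funext fun _ => Prod.ext (map_zero _) (map_zero _)
  map_add' _ _ := funext fun _ => Prod.ext (map_add _ _ _) (map_add _ _ _)

variable (s t : PairFamily U V) (i : ι) {W : S.Opens} (hV : W ≤ V) (hi : W ≤ U i)

@[simp] lemma resO_fst {W' : S.Opens} (h : W' ≤ W) :
    resO h (s.fst i hV hi) = s.fst i (h.trans hV) (h.trans hi) := resO_resO _ _ _

@[simp] lemma resO_snd {W' : S.Opens} (h : W' ≤ W) :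
    resO h (s.snd i hV hi) = s.snd i (h.trans hV) (h.trans hi) := resO_resO _ _ _

@[simp] lemma fst_restrict {V' : S.Opens} (h : V' ≤ V) (hV : W ≤ V') :
    (restrict h s).fst i hV hi = s.fst i (hV.trans h) hi := resO_resO _ _ _

@[simp] lemma snd_restrict {V' : S.Opens} (h : V' ≤ V) (hV : W ≤ V') :
    (restrict h s).snd i hV hi = s.snd i (hV.trans h) hi := resO_resO _ _ _

@[simp] lemma fst_add : (s + t).fst i hV hi = s.fst i hV hi + t.fst i hV hi := map_add _ _ _

@[simp] lemma snd_add : (s + t).snd i hV hi = s.snd i hV hi + t.snd i hV hi := map_add _ _ _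

@[simp] lemma fst_zero : (0 : PairFamily U V).fst i hV hi = 0 := map_zero _

@[simp] lemma snd_zero : (0 : PairFamily U V).snd i hV hi = 0 := map_zero _

@[simp] lemma fst_neg : (-s).fst i hV hi = -s.fst i hV hi := map_neg _ _

@[simp] lemma snd_neg : (-s).snd i hV hi = -s.snd i hV hi := map_neg _ _

@[simp] lemma fst_smul (r : Γ(S, V)) : (r • s).fst i hV hi = resO hV r * s.fst i hV hi := by
  change resO (le_inf hV hi) (resO inf_le_left r * (s i).1) = _
  rw [map_mul, resO_resO]; rfl

@[simp] lemma snd_smul (r : Γ(S, V)) : (r • s).snd i hV hi = resO hV r * s.snd i hV hi := by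
  change resO (le_inf hV hi) (resO inf_le_left r * (s i).2) = _
  rw [map_mul, resO_resO]; rfl

variable {s t} in
lemma ext_coeff (h : ∀ i (W : S.Opens) (hV : W ≤ V) (hi : W ≤ U i),
    s.fst i hV hi = t.fst i hV hi ∧ s.snd i hV hi = t.snd i hV hi) : s = t := by
  funext i
  obtain ⟨h1, h2⟩ := h i _ inf_le_left inf_le_right
  exact Prod.ext (by simpa only [fst, resO_self] using h1) (by simpa only [snd, resO_self] using h2)

/-- The family with prescribed coefficients. -/
def mk (x y : ∀ i, Γ(S, V ⊓ U i)) : PairFamily U V := fun i => (x i, y i)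

@[simp] lemma fst_mk (x y : ∀ i, Γ(S, V ⊓ U i)) :
    (mk x y).fst i hV hi = resO (le_inf hV hi) (x i) := rfl

@[simp] lemma snd_mk (x y : ∀ i, Γ(S, V ⊓ U i)) :
    (mk x y).snd i hV hi = resO (le_inf hV hi) (y i) := rfl

end PairFamily

/-! ### The sheaf of compatible families -/

section GluedModule

variable {N : S.Modules} {ι : Type u} {U : ι → S.Opens} (ν : ∀ i, Γ(N, U i)) (p : ∀ i, Γ(S, U i))

/-- The families `(x_i, y_i)` for which the sections `x_i + y_i ω_i` coincide on overlaps, where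
`ω_i = (δ_i - p_i) / 2` and the `δ_i` transform like the dual basis of `ν_i`. -/
def gluedSections (V : S.Opens) : Submodule Γ(S, V) (PairFamily U V) where
  carrier := {s | ∀ i j (W : S.Opens) (hV : W ≤ V) (hi : W ≤ U i) (hj : W ≤ U j),
    s.snd i hV hi • res N hj (ν j) = s.snd j hV hj • res N hi (ν i) ∧
    2 * s.fst i hV hi - resO hi (p i) * s.snd i hV hi =
      2 * s.fst j hV hj - resO hj (p j) * s.snd j hV hj}
  add_mem' {s t} hs ht i j W hV hi hj := by
    obtain ⟨h1, h2⟩ := hs i j W hV hi hj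
    obtain ⟨h3, h4⟩ := ht i j W hV hi hj
    simp only [PairFamily.fst_add, PairFamily.snd_add, add_smul]
    exact ⟨by rw [h1, h3], by linear_combination h2 + h4⟩
  zero_mem' i j W hV hi hj := by simp
  smul_mem' r s hs i j W hV hi hj := by
    obtain ⟨h1, h2⟩ := hs i j W hV hi hj
    simp only [PairFamily.fst_smul, PairFamily.snd_smul, mul_smul]
    exact ⟨by rw [h1], by linear_combination resO hV r * h2⟩

/-- Restriction of the sections of the glued module. -/
def gluedRes {V V' : S.Opens} (h : V' ≤ V) : gluedSections ν p V →+ gluedSections ν p V' where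
  toFun s := ⟨PairFamily.restrict h s.1, fun i j W hV hi hj => by
    simpa only [PairFamily.fst_restrict, PairFamily.snd_restrict] using
      s.2 i j W (hV.trans h) hi hj⟩
  map_zero' := Subtype.ext (map_zero _)
  map_add' _ _ := Subtype.ext (map_add _ _ _)

lemma gluedRes_self {V : S.Opens} (s : gluedSections ν p V) : gluedRes ν p le_rfl s = s :=
  Subtype.ext (PairFamily.ext_coeff fun i W hV hi => by simp [gluedRes])

lemma gluedRes_gluedRes {V V' V'' : S.Opens} (h : V' ≤ V) (h' : V'' ≤ V')
    (s : gluedSections ν p V) :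
    gluedRes ν p h' (gluedRes ν p h s) = gluedRes ν p (h'.trans h) s :=
  Subtype.ext (PairFamily.ext_coeff fun i W hV hi => by simp [gluedRes])

/-- The presheaf of sections of the glued module. -/
def gluedPresheaf : TopCat.Presheaf Ab.{u} S where
  obj V := AddCommGrpCat.of (gluedSections ν p V.unop)
  map f := AddCommGrpCat.ofHom (gluedRes ν p (leOfHom f.unop))
  map_id _ := AddCommGrpCat.hom_ext (AddMonoidHom.ext fun s => gluedRes_self ν p s)
  map_comp f g := AddCommGrpCat.hom_ext (AddMonoidHom.ext fun s =>
    (gluedRes_gluedRes ν p (leOfHom f.unop) (leOfHom g.unop) s).symm)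

instance (V : (TopologicalSpace.Opens S)ᵒᵖ) :
    Module (S.ringCatSheaf.obj.obj V) ((gluedPresheaf ν p).obj V) :=
  inferInstanceAs (Module Γ(S, V.unop) (gluedSections ν p V.unop))

lemma gluedPresheaf_map_smul ⦃V V' : (TopologicalSpace.Opens S)ᵒᵖ⦄ (f : V ⟶ V')
    (r : S.ringCatSheaf.obj.obj V) (s : (gluedPresheaf ν p).obj V) :
    (gluedPresheaf ν p).map f (r • s) =
      S.ringCatSheaf.obj.map f r • (gluedPresheaf ν p).map f s := by
  have key : ∀ {V V' : S.Opens} (h : V' ≤ V) (r : Γ(S, V)) (s : gluedSections ν p V),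
      gluedRes ν p h (r • s) = resO h r • gluedRes ν p h s := fun h r s =>
    Subtype.ext (PairFamily.ext_coeff fun i W hV hi => by
      simp [gluedRes, resO_resO])
  exact key (leOfHom f.unop) (show Γ(S, V.unop) from r) s

/-- The coefficients glue because `𝒪` is a sheaf, and the compatibility conditions are equations in
sheaves, so they can be checked locally. -/
lemma gluedPresheaf_isSheaf : (gluedPresheaf ν p).IsSheaf := by
  rw [TopCat.Presheaf.isSheaf_iff_isSheafUniqueGluing]
  intro κ O sf hsf
  let s : ∀ k, gluedSections ν p (O k) := sf
  have hs : ∀ k l i (W : S.Opens) (hk : W ≤ O k) (hl : W ≤ O l) (hi : W ≤ U i),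
      (s k).1.fst i hk hi = (s l).1.fst i hl hi ∧ (s k).1.snd i hk hi = (s l).1.snd i hl hi := by
    intro k l i W hk hl hi
    have h : gluedRes ν p (inf_le_left : O k ⊓ O l ≤ O k) (s k) = gluedRes ν p inf_le_right (s l) :=
      hsf k l
    constructor
    · simpa [gluedRes] using congrArg (fun t => PairFamily.fst t.1 i (le_inf hk hl) hi) h
    · simpa [gluedRes] using congrArg (fun t => PairFamily.snd t.1 i (le_inf hk hl) hi) h
  have hcov : ∀ i, iSup O ⊓ U i ≤ ⨆ k, O k ⊓ U i := fun i => (iSup_inf_eq _ _).le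
  have hle : ∀ i k, O k ⊓ U i ≤ iSup O ⊓ U i := fun i k => inf_le_inf_right _ (le_iSup O k)
  choose x hx hx' using fun i => resO_glue (fun k => O k ⊓ U i) _ (hle i) (hcov i)
    (fun k => (s k).1.fst i inf_le_left inf_le_right) fun k l => by
      simpa using (hs k l i _ (inf_le_left.trans inf_le_left) (inf_le_right.trans inf_le_left)
        (inf_le_left.trans inf_le_right)).1
  choose y hy hy' using fun i => resO_glue (fun k => O k ⊓ U i) _ (hle i) (hcov i)
    (fun k => (s k).1.snd i inf_le_left inf_le_right) fun k l => by
      simpa using (hs k l i _ (inf_le_left.trans inf_le_left) (inf_le_right.trans inf_le_left)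
        (inf_le_left.trans inf_le_right)).2
  have hfst : ∀ i k (W : S.Opens) (hk : W ≤ O k) (hV : W ≤ iSup O) (hi : W ≤ U i),
      (PairFamily.mk x y).fst i hV hi = (s k).1.fst i hk hi := fun i k W hk hV hi => by
    have := congrArg (resO (le_inf hk hi)) (hx i k)
    rwa [resO_resO, PairFamily.resO_fst] at this
  have hsnd : ∀ i k (W : S.Opens) (hk : W ≤ O k) (hV : W ≤ iSup O) (hi : W ≤ U i),
      (PairFamily.mk x y).snd i hV hi = (s k).1.snd i hk hi := fun i k W hk hV hi => by
    have := congrArg (resO (le_inf hk hi)) (hy i k)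
    rwa [resO_resO, PairFamily.resO_snd] at this
  have hmem : PairFamily.mk x y ∈ gluedSections ν p (iSup O) := by
    intro i j W hV hi hj
    constructor
    · refine res_ext_local fun z hz => ?_
      obtain ⟨k, hk⟩ := TopologicalSpace.Opens.mem_iSup.mp (hV hz)
      refine ⟨W ⊓ O k, inf_le_left, ⟨hz, hk⟩, ?_⟩
      simp only [res_smul, res_res, PairFamily.resO_snd]
      rw [hsnd i k _ inf_le_right, hsnd j k _ inf_le_right]
      exact ((s k).2 i j _ _ _ _).1
    · refine resO_ext_local fun z hz => ?_
      obtain ⟨k, hk⟩ := TopologicalSpace.Opens.mem_iSup.mp (hV hz)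
      refine ⟨W ⊓ O k, inf_le_left, ⟨hz, hk⟩, ?_⟩
      simp only [map_sub, map_mul, map_ofNat, resO_resO, PairFamily.resO_snd, PairFamily.resO_fst]
      rw [hsnd i k _ inf_le_right, hsnd j k _ inf_le_right, hfst i k _ inf_le_right,
        hfst j k _ inf_le_right]
      exact ((s k).2 i j _ _ _ _).2
  refine ⟨(⟨_, hmem⟩ : gluedSections ν p (iSup O)), fun k => ?_, fun t ht => ?_⟩
  · refine Subtype.ext (PairFamily.ext_coeff fun i W hV hi => ⟨?_, ?_⟩)
    · exact (PairFamily.fst_restrict _ i hi _ hV).trans (hfst i k W hV _ hi)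
    · exact (PairFamily.snd_restrict _ i hi _ hV).trans (hsnd i k W hV _ hi)
  · let t' : gluedSections ν p (iSup O) := t
    have ht' : ∀ k, gluedRes ν p (le_iSup O k) t' = s k := ht
    refine Subtype.ext (funext fun i => Prod.ext (hx' i _ fun k => ?_) (hy' i _ fun k => ?_))
    · have h := congrArg (fun t => PairFamily.fst t.1 i (W := O k ⊓ U i) inf_le_left inf_le_right)
        (ht' k)
      exact (t'.1.fst_restrict i _ _ _).symm.trans h
    · have h := congrArg (fun t => PairFamily.snd t.1 i (W := O k ⊓ U i) inf_le_left inf_le_right)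
        (ht' k)
      exact (t'.1.snd_restrict i _ _ _).symm.trans h

/-- The module underlying the glued algebra. -/
def gluedModule : S.Modules where
  val := PresheafOfModules.ofPresheaf (gluedPresheaf ν p) (gluedPresheaf_map_smul ν p)
  isSheaf := gluedPresheaf_isSheaf ν p

end GluedModule

/-! ### Multiplication and generators of the glued algebra -/

section GluedAlgebra

variable {N : S.Modules} {ι : Type u} {U : ι → S.Opens}

/-- The generators `ν_i` of `N` and the coefficients `p_i`, `a_i` satisfy the identities on overlaps
needed to glue the algebras `𝒪[ω_i]/⟨ω_i² + p_i ω_i - a_i⟩`. -/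
structure IsGlueingDatum (ν : ∀ i, Γ(N, U i)) (p a : ∀ i, Γ(S, U i)) : Prop where
  basis : ∀ i, IsBasisOn N ![ν i]
  exists_half : ∀ i j (W : S.Opens) (hi : W ≤ U i) (hj : W ≤ U j) (ε : Γ(S, W)),
    res N hj (ν j) = ε • res N hi (ν i) → ∃ b, 2 * b = ε * resO hj (p j) - resO hi (p i)
  disc : ∀ i j (W : S.Opens) (hi : W ≤ U i) (hj : W ≤ U j) (ε : Γ(S, W)),
    res N hj (ν j) = ε • res N hi (ν i) →
      resO hi (p i) ^ 2 + 4 * resO hi (a i) = ε ^ 2 * (resO hj (p j) ^ 2 + 4 * resO hj (a j))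

namespace PairFamily

variable {V : S.Opens} (p a : ∀ i, Γ(S, U i)) (s t : PairFamily U V)

/-- The product of families `x_i + y_i ω_i`, where `ω_i² = a_i - p_i ω_i`. -/
def mul : PairFamily U V :=
  mk (fun i => s.fst i inf_le_left inf_le_right * t.fst i inf_le_left inf_le_right +
      resO inf_le_right (a i) * s.snd i inf_le_left inf_le_right *
        t.snd i inf_le_left inf_le_right)
    (fun i => s.fst i inf_le_left inf_le_right * t.snd i inf_le_left inf_le_right +
      s.snd i inf_le_left inf_le_right * t.fst i inf_le_left inf_le_right -
      resO inf_le_right (p i) * s.snd i inf_le_left inf_le_right *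
        t.snd i inf_le_left inf_le_right)

variable (i : ι) {W : S.Opens} (hV : W ≤ V) (hi : W ≤ U i)

@[simp] lemma fst_mul : (mul p a s t).fst i hV hi =
    s.fst i hV hi * t.fst i hV hi + resO hi (a i) * s.snd i hV hi * t.snd i hV hi := by
  simp [mul, resO_resO]

@[simp] lemma snd_mul : (mul p a s t).snd i hV hi =
    s.fst i hV hi * t.snd i hV hi + s.snd i hV hi * t.fst i hV hi -
      resO hi (p i) * s.snd i hV hi * t.snd i hV hi := by
  simp [mul, resO_resO]

end PairFamily

namespace IsGlueingDatum

variable {ν : ∀ i, Γ(N, U i)} {p a : ∀ i, Γ(S, U i)}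

lemma snd_eq (h : IsGlueingDatum ν p a) {V : S.Opens} {s : PairFamily U V}
    (hs : s ∈ gluedSections ν p V) {i j : ι} {W : S.Opens} (hV : W ≤ V) (hi : W ≤ U i)
    (hj : W ≤ U j) {ε : Γ(S, W)} (hε : res N hj (ν j) = ε • res N hi (ν i)) :
    s.snd j hV hj = s.snd i hV hi * ε := by
  have h1 := (hs i j W hV hi hj).1
  rw [hε, smul_smul] at h1
  exact ((h.basis i).smul_injective hi h1).symm

lemma mem_of_snd_eq (h : IsGlueingDatum ν p a) {V : S.Opens} {s : PairFamily U V}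
    (hs : ∀ i j (W : S.Opens) (hV : W ≤ V) (hi : W ≤ U i) (hj : W ≤ U j) (ε : Γ(S, W)),
      res N hj (ν j) = ε • res N hi (ν i) → s.snd j hV hj = s.snd i hV hi * ε ∧
      2 * s.fst i hV hi - resO hi (p i) * s.snd i hV hi =
        2 * s.fst j hV hj - resO hj (p j) * s.snd j hV hj) : s ∈ gluedSections ν p V := by
  intro i j W hV hi hj
  obtain ⟨ε, hε⟩ := (h.basis i).exists_smul hi (res N hj (ν j))
  obtain ⟨h1, h3⟩ := hs i j W hV hi hj ε hε
  exact ⟨by rw [hε, h1, smul_smul], h3⟩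

lemma mul_mem (h2 : TwoIsRegular S) (h : IsGlueingDatum ν p a) {V : S.Opens} {s t : PairFamily U V}
    (hs : s ∈ gluedSections ν p V) (ht : t ∈ gluedSections ν p V) :
    PairFamily.mul p a s t ∈ gluedSections ν p V := by
  refine h.mem_of_snd_eq fun i j W hV hi hj ε hε => ?_
  have hd := h.disc i j W hi hj ε hε
  have hs1 := h.snd_eq hs hV hi hj hε
  have ht1 := h.snd_eq ht hV hi hj hε
  have hs2 := (hs i j W hV hi hj).2
  have ht2 := (ht i j W hV hi hj).2
  simp only [PairFamily.fst_mul, PairFamily.snd_mul]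
  constructor
  -- With `T = 2x - p y`, twice the `ω`-coefficient of a product is `T(s) y_t + y_s T(t)`; here `T`
  -- is the same for `i` and `j`, and each `y` is multiplied by `ε`.
  · refine h2.eq_of_two_mul_eq ?_
    linear_combination (2 * t.fst j hV hj - resO hj (p j) * t.snd j hV hj) * hs1 +
      (2 * s.fst j hV hj - resO hj (p j) * s.snd j hV hj) * ht1 -
      t.snd i hV hi * ε * hs2 - s.snd i hV hi * ε * ht2
  -- One has `2 T(st) = T(s) T(t) + (p² + 4a) y_s y_t`, and the last term is the same for `i` and
  -- `j` by the equality of discriminants.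
  · refine h2.eq_of_two_mul_eq ?_
    rw [hs1] at hs2 ⊢
    rw [ht1] at ht2 ⊢
    linear_combination (2 * t.fst i hV hi - resO hi (p i) * t.snd i hV hi) * hs2 +
      (2 * s.fst j hV hj - resO hj (p j) * (s.snd i hV hi * ε)) * ht2 +
      s.snd i hV hi * t.snd i hV hi * hd

/-- A section of the glued module over an open of `U_i` is determined by its `i`-th component. -/
lemma ext_of_le (h2 : TwoIsRegular S) (h : IsGlueingDatum ν p a) {V : S.Opens} {i : ι}
    (hVi : V ≤ U i) {s t : gluedSections ν p V}
    (hfst : s.1.fst i le_rfl hVi = t.1.fst i le_rfl hVi)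
    (hsnd : s.1.snd i le_rfl hVi = t.1.snd i le_rfl hVi) : s = t := by
  refine Subtype.ext (PairFamily.ext_coeff fun j W hV hj => ?_)
  have h1 := congrArg (resO hV) hfst
  have h3 := congrArg (resO hV) hsnd
  simp only [PairFamily.resO_fst, PairFamily.resO_snd] at h1 h3
  obtain ⟨ε, hε⟩ := (h.basis i).exists_smul (hV.trans hVi) (res N hj (ν j))
  have hs1 := h.snd_eq s.2 hV (hV.trans hVi) hj hε
  have ht1 := h.snd_eq t.2 hV (hV.trans hVi) hj hε
  have hs2 := (s.2 i j W hV (hV.trans hVi) hj).2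
  have ht2 := (t.2 i j W hV (hV.trans hVi) hj).2
  have h4 : s.1.snd j hV hj = t.1.snd j hV hj := by rw [hs1, ht1, h3]
  -- The invariance of `2x - p y` determines `2 x_j` from the `i`-th pair, and 2 can be cancelled.
  refine ⟨h2.eq_of_two_mul_eq ?_, h4⟩
  linear_combination ht2 - hs2 + 2 * h1 - resO (hV.trans hVi) (p i) * h3 + resO hj (p j) * h4

end IsGlueingDatum

variable (ν : ∀ i, Γ(N, U i)) (p : ∀ i, Γ(S, U i))

/-- The unit section of the glued algebra. -/
def gluedOne (V : S.Opens) : gluedSections ν p V :=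
  ⟨PairFamily.mk (fun _ => 1) (fun _ => 0), fun i j W hV hi hj => by simp⟩

lemma gluedRes_one {V V' : S.Opens} (h : V' ≤ V) :
    gluedRes ν p h (gluedOne ν p V) = gluedOne ν p V' :=
  Subtype.ext (PairFamily.ext_coeff fun i W hV hi => by simp [gluedRes, gluedOne])

/-- The structure morphism of the glued algebra. -/
def gluedUnit : structureModule S ⟶ gluedModule ν p :=
  (SheafOfModules.unitHomEquiv (gluedModule ν p)).symm
    ⟨fun V => gluedOne ν p V.unop, fun f => gluedRes_one ν p (leOfHom f.unop)⟩

lemma gluedUnit_app_one (V : S.Opens) :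
    (gluedUnit ν p).app V (show Γ(structureModule S, V) from (1 : Γ(S, V))) =
      (show Γ(gluedModule ν p, V) from gluedOne ν p V) :=
  (SheafOfModules.unitHomEquiv_apply_coe (gluedModule ν p) (gluedUnit ν p) (op V)).symm.trans
    (congrArg (fun s : SheafOfModules.sections (gluedModule ν p) => s.val (op V))
      (Equiv.apply_symm_apply (SheafOfModules.unitHomEquiv (gluedModule ν p)) _))

variable {ν p} {a : ∀ i, Γ(S, U i)}

/-- The multiplication of the glued algebra. -/
def gluedMul (h2 : TwoIsRegular S) (h : IsGlueingDatum ν p a) (V : S.Opens) :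
    gluedSections ν p V →ₗ[Γ(S, V)] gluedSections ν p V →ₗ[Γ(S, V)] gluedSections ν p V :=
  LinearMap.mk₂ _ (fun s t => ⟨PairFamily.mul p a s.1 t.1, h.mul_mem h2 s.2 t.2⟩)
    (fun s s' t => Subtype.ext (PairFamily.ext_coeff fun i W hV hi => by
      constructor <;> simp <;> ring))
    (fun r s t => Subtype.ext (PairFamily.ext_coeff fun i W hV hi => by
      constructor <;> simp <;> ring))
    (fun s t t' => Subtype.ext (PairFamily.ext_coeff fun i W hV hi => by
      constructor <;> simp <;> ring))
    (fun r s t => Subtype.ext (PairFamily.ext_coeff fun i W hV hi => by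
      constructor <;> simp <;> ring))

/-- The glued algebra. -/
def gluedAlgebra (h2 : TwoIsRegular S) (h : IsGlueingDatum ν p a) : OAlgebra S where
  toModule := gluedModule ν p
  unit := gluedUnit ν p
  mul V := gluedMul h2 h V
  res_mul V V' hV' s t := by
    have key : ∀ s t : gluedSections ν p V, gluedRes ν p hV' (gluedMul h2 h V s t) =
        gluedMul h2 h V' (gluedRes ν p hV' s) (gluedRes ν p hV' t) := fun s t =>
      Subtype.ext (PairFamily.ext_coeff fun i W hV hi => by simp [gluedRes, gluedMul])
    exact key s t
  mul_assoc V s t r := by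
    -- Each component multiplies as in `𝒪[ω]/⟨ω² + pω - a⟩`, so associativity is a polynomial
    -- identity.
    have key : ∀ s t r : gluedSections ν p V, gluedMul h2 h V (gluedMul h2 h V s t) r =
        gluedMul h2 h V s (gluedMul h2 h V t r) := fun s t r =>
      Subtype.ext (PairFamily.ext_coeff fun i W hV hi => by
        constructor <;> simp [gluedMul] <;> ring)
    exact key s t r
  one_mul V s := by
    have key : ∀ s : gluedSections ν p V, gluedMul h2 h V (gluedOne ν p V) s = s := fun s =>
      Subtype.ext (PairFamily.ext_coeff fun i W hV hi => by simp [gluedMul, gluedOne])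
    exact (congrArg (fun e => gluedMul h2 h V e s) (gluedUnit_app_one ν p V)).trans (key s)
  mul_one V s := by
    have key : ∀ s : gluedSections ν p V, gluedMul h2 h V s (gluedOne ν p V) = s := fun s =>
      Subtype.ext (PairFamily.ext_coeff fun i W hV hi => by simp [gluedMul, gluedOne])
    exact (congrArg (fun e => gluedMul h2 h V s e) (gluedUnit_app_one ν p V)).trans (key s)

/-- The section `ω_i` of the glued module over `U_i`. -/
lemma IsGlueingDatum.exists_generator (h2 : TwoIsRegular S) (h : IsGlueingDatum ν p a) (i : ι) :
    ∃ s : gluedSections ν p (U i), s.1.fst i le_rfl le_rfl = 0 ∧ s.1.snd i le_rfl le_rfl = 1 := by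
  choose ε hε using fun j => (h.basis i).exists_smul (inf_le_left : U i ⊓ U j ≤ U i)
    (res N inf_le_right (ν j))
  choose b hb using fun j => h.exists_half i j _ _ _ (ε j) (hε j)
  have hεi : ε i = 1 := (h.basis i).smul_injective inf_le_left (by rw [← hε, one_smul])
  have hbi : b i = 0 := h2 _ _ (by rw [hb, hεi, one_mul]; exact sub_self _)
  -- The `j`-th component expresses `ω_i = b_j + ε_j ω_j`; the common value of `2x - p y` is `-p_i`.
  refine ⟨⟨PairFamily.mk b ε, fun j k W hV hj hk => ?_⟩, ?_, ?_⟩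
  · have h1 := congrArg (res N (le_inf hV hj)) (hε j)
    have h3 := congrArg (res N (le_inf hV hk)) (hε k)
    have h4 := congrArg (resO (le_inf hV hj)) (hb j)
    have h5 := congrArg (resO (le_inf hV hk)) (hb k)
    simp only [res_res, resO_resO, res_smul, map_mul, map_sub, map_ofNat] at h1 h3 h4 h5
    simp only [PairFamily.fst_mk, PairFamily.snd_mk]
    refine ⟨by rw [h1, h3, smul_smul, smul_smul, mul_comm], ?_⟩
    linear_combination h4 - h5
  · simp [hbi]
  · simp [hεi]

lemma IsGlueingDatum.exists_isGlueing (h2 : TwoIsRegular S) (h : IsGlueingDatum ν p a) :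
    ∃ (Ω : OAlgebra S) (ω : ∀ i, Γ(Ω.toModule, U i)), IsGlueing ν p a Ω ω := by
  choose ω hω₀ hω₁ using h.exists_generator h2
  have hres : ∀ i (V : S.Opens) (hV : V ≤ U i),
      (gluedRes ν p hV (ω i)).1.fst i le_rfl hV = 0 ∧
      (gluedRes ν p hV (ω i)).1.snd i le_rfl hV = 1 := fun i V hV => by
    have h0 := congrArg (resO hV) (hω₀ i)
    have h1 := congrArg (resO hV) (hω₁ i)
    simp only [PairFamily.resO_fst, PairFamily.resO_snd, map_zero, map_one] at h0 h1
    simp [gluedRes, h0, h1]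
  have hone : ∀ V, (gluedAlgebra h2 h).one V = gluedOne ν p V := gluedUnit_app_one ν p
  refine ⟨gluedAlgebra h2 h, ω, fun i => ⟨isBasisOn_pair.mpr fun V hV => ?_, ?_⟩, fun i j => ?_⟩
  -- The `i`-th component of `c₁ + c₂ ω_i` is `(c₁, c₂)`, and over an open of `U_i` this component
  -- determines the section.
  · have key : Function.Bijective fun c : Γ(S, V) × Γ(S, V) =>
        c.1 • gluedOne ν p V + c.2 • gluedRes ν p hV (ω i) := by
      obtain ⟨h0, h1⟩ := hres i V hV
      refine ⟨fun c c' hc => ?_, fun s => ⟨(s.1.fst i le_rfl hV, s.1.snd i le_rfl hV),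
        h.ext_of_le h2 hV ?_ ?_⟩⟩
      · have e0 := congrArg (fun s => PairFamily.fst s.1 i le_rfl hV) hc
        have e1 := congrArg (fun s => PairFamily.snd s.1 i le_rfl hV) hc
        simp [gluedOne, h0, h1] at e0 e1
        exact Prod.ext e0 e1
      · simp [gluedOne, h0]
      · simp [gluedOne, h1]
    have e : res (gluedAlgebra h2 h).toModule hV ((gluedAlgebra h2 h).one (U i)) =
        gluedOne ν p V := ((gluedAlgebra h2 h).res_one hV).trans (hone V)
    rw [e]
    exact key
  · have key : gluedMul h2 h (U i) (ω i) (ω i) + p i • ω i + -a i • gluedOne ν p (U i) = 0 := by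
      refine h.ext_of_le h2 le_rfl ?_ ?_
      · simp [gluedMul, gluedOne, hω₀, hω₁]
      · simp [gluedMul, gluedOne, hω₀, hω₁]
    rw [hone]
    exact key
  · obtain ⟨ε, hε⟩ := (h.basis i).exists_smul (inf_le_left : U i ⊓ U j ≤ U i)
      (res N inf_le_right (ν j))
    obtain ⟨δ, hδ⟩ := (h.basis j).exists_smul (inf_le_right : U i ⊓ U j ≤ U j)
      (res N inf_le_left (ν i))
    -- Exchanging `i` and `j` supplies the inverse of `ε`.
    have hεδ : ε * δ = 1 := (h.basis j).smul_injective inf_le_right (by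
      rw [one_smul, mul_smul, ← hδ, ← hε])
    obtain ⟨b, hb⟩ := h.exists_half i j _ _ _ ε hε
    refine ⟨⟨ε, δ, hεδ, by rw [mul_comm, hεδ]⟩, b, hε, hb, ?_⟩
    have key : gluedRes ν p (inf_le_left : U i ⊓ U j ≤ U i) (ω i) =
        ε • gluedRes ν p inf_le_right (ω j) + b • gluedOne ν p (U i ⊓ U j) := by
      obtain ⟨i0, i1⟩ := hres i (U i ⊓ U j) inf_le_left
      obtain ⟨j0, j1⟩ := hres j (U i ⊓ U j) inf_le_right
      have m1 := h.snd_eq (gluedRes ν p inf_le_left (ω i)).2 le_rfl inf_le_left inf_le_right hε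
      have m2 := ((gluedRes ν p inf_le_left (ω i)).2 i j (U i ⊓ U j) le_rfl inf_le_left
        inf_le_right).2
      rw [i1, one_mul] at m1
      rw [i0, i1, m1] at m2
      -- It suffices to compare `j`-th components: that of `ω_i` has second entry `ε`, and twice its
      -- first entry is `ε p_j - p_i`, which is `2b`.
      refine h.ext_of_le h2 inf_le_right (h2.eq_of_two_mul_eq ?_) ?_
      · simp only [Submodule.coe_add, Submodule.coe_smul, PairFamily.fst_add, PairFamily.fst_smul,
          j0, resO_self]
        simp only [gluedOne, PairFamily.fst_mk, map_one]
        linear_combination -hb - m2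
      · simp only [Submodule.coe_add, Submodule.coe_smul, PairFamily.snd_add, PairFamily.snd_smul,
          j1, m1, resO_self]
        simp [gluedOne]
    rw [hone]
    exact key

end GluedAlgebra

/-! ### From an adapted covering to the glued algebra -/

section Main

variable {N : S.Modules} {ι : Type u} {U : ι → S.Opens} {ν : ∀ i, Γ(N, U i)}
  {p a : ∀ i, Γ(S, U i)} {Δ : Γ(tensor N N, (⊤ : S.Opens))} {P : Γ(modTwo N, (⊤ : S.Opens))}

/-- Both identities come from restricting one global section in two ways: `P` yields the
divisibility by 2, and `Δ`, read in the basis `ν_i ⊗ ν_i`, the equality of discriminants. -/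
lemma isGlueingDatum_of_res_eq (h2 : TwoIsRegular S) (hν : ∀ i, IsBasisOn N ![ν i])
    (hΔ : ∀ i, res _ (le_top : U i ≤ ⊤) Δ = (p i ^ 2 + 4 * a i) • tmul (ν i) (ν i))
    (hP : ∀ i, res _ (le_top : U i ≤ ⊤) P = (toModTwo N).app (U i) (p i • ν i)) :
    IsGlueingDatum ν p a where
  basis := hν
  exists_half i j W hi hj ε hε := by
    have h1 := congrArg (res _ hi) (hP i)
    have h3 := congrArg (res _ hj) (hP j)
    rw [res_res, ← app_res, res_smul] at h1 h3
    rw [hε, smul_smul, h1] at h3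
    obtain ⟨b, hb⟩ := exists_eq_two_mul_of_toModTwo_eq h2 ((hν i).restrict_singleton hi) h3.symm
    exact ⟨b, by rw [← hb, mul_comm]⟩
  disc i j W hi hj ε hε := by
    have h1 := congrArg (res _ hi) (hΔ i)
    have h3 := congrArg (res _ hj) (hΔ j)
    rw [res_res, res_smul, res_tmul] at h1 h3
    rw [hε, smul_tmul_smul, smul_smul, h1, ← res_tmul] at h3
    have h4 := (isBasisOn_tmul (hν i) (hν i)).smul_injective hi h3
    simp only [map_add, map_pow, map_mul, map_ofNat] at h4
    rw [h4]
    ring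

lemma IsAdaptedCover.exists_glueing (h2 : TwoIsRegular S) (hU : IsAdaptedCover N Δ P U)
    {t : ∀ i, Γ(N, U i)} (hν : ∀ i, IsBasisOn N ![ν i]) (ht : ∀ i, IsLift P (t i)) :
    ∃ p d a : ∀ i, Γ(S, U i),
      (∀ i, t i = p i • ν i) ∧
      (∀ i, res _ (le_top : U i ≤ ⊤) Δ = d i • tmul (ν i) (ν i)) ∧
      (∀ i, 4 * a i = d i - p i ^ 2) ∧
      ∃ (Ω : OAlgebra S) (f : dual Ω.quot ≅ N) (ω : ∀ i, Γ(Ω.toModule, U i)),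
        Ω.IsQuadratic ∧ HasTypeVia Ω f Δ P ∧ IsGlueing ν p a Ω ω ∧
        ∀ i, ∃ μ : Γ(dual Ω.quot, U i), Ω.IsDualBar (ω i) μ ∧ f.hom.app (U i) μ = ν i := by
  choose p hp using fun i => (hν i).exists_smul le_rfl (t i)
  choose c hc using fun i => hU.congr i (t i) (ht i)
  choose a ha using fun i => (isBasisOn_tmul (hν i) (hν i)).exists_smul le_rfl (c i)
  simp only [res_self] at hp ha
  -- The quotient `a_i` is the coordinate of the section `c_i` witnessing the congruence, so `d_i`
  -- is taken to be `p_i² + 4 a_i`.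
  have hΔ : ∀ i, res _ (le_top : U i ≤ ⊤) Δ = (p i ^ 2 + 4 * a i) • tmul (ν i) (ν i) := fun i => by
    rw [hc, hp, ha, smul_tmul_smul, smul_smul, ← add_smul, sq]
  have hP : ∀ i, res _ (le_top : U i ≤ ⊤) P = (toModTwo N).app (U i) (p i • ν i) := fun i => by
    rw [← hp]
    exact (ht i).symm
  obtain ⟨Ω, ω, hΩ⟩ := (isGlueingDatum_of_res_eq h2 hν hΔ hP).exists_isGlueing h2
  obtain ⟨f, μ, hμ, hf⟩ := hΩ.exists_iso hU.covers hν
  exact ⟨p, _, a, hp, hΔ, fun i => (add_sub_cancel_left _ _).symm, Ω, f, ω,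
    hΩ.isQuadratic hU.covers, hΩ.hasTypeVia hU.covers hμ hf hΔ hP, hΩ, fun i => ⟨μ i, hμ i, hf i⟩⟩

lemma IsAdaptedCover.isValid (h2 : TwoIsRegular S) (hU : IsAdaptedCover N Δ P U) :
    IsValid N Δ P := by
  choose ν hν using hU.free
  choose t ht using hU.exists_lift
  obtain ⟨-, -, -, -, -, -, Ω, f, -, hΩ, hf, -⟩ := hU.exists_glueing h2 hν ht
  exact ⟨Ω, f, hΩ, hf⟩

end Main

end

end SchemeQuadratic

theorem mainTheorem5 (S : Scheme.{u}) (h2 : TwoIsRegular S)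
    (N : S.Modules) (hN : IsLocallyFreeOfRank N 1)
    (Δ : Γ(tensor N N, (⊤ : S.Opens))) (P : Γ(modTwo N, (⊤ : S.Opens))) :
    (IsValid N Δ P ↔ ∃ (ι : Type u) (U : ι → S.Opens), IsAdaptedCover N Δ P U) ∧
    (∀ (ι : Type u) (U : ι → S.Opens), IsAdaptedCover N Δ P U →
      ∀ (ν : ∀ i, Γ(N, U i)) (t : ∀ i, Γ(N, U i)),
        (∀ i, IsBasisOn N ![ν i]) → (∀ i, IsLift P (t i)) →
        ∃ p d a : ∀ i, Γ(S, U i),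
          (∀ i, t i = p i • ν i) ∧
          (∀ i, res _ (le_top : U i ≤ ⊤) Δ = d i • tmul (ν i) (ν i)) ∧
          (∀ i, 4 * a i = d i - p i ^ 2) ∧
          ∃ (Ω : OAlgebra S) (f : dual Ω.quot ≅ N) (ω : ∀ i, Γ(Ω.toModule, U i)),
            Ω.IsQuadratic ∧ HasTypeVia Ω f Δ P ∧ IsGlueing ν p a Ω ω ∧
            ∀ i, ∃ μ : Γ(dual Ω.quot, U i), Ω.IsDualBar (ω i) μ ∧ f.hom.app (U i) μ = ν i) :=
  ⟨⟨fun h => h.exists_isAdaptedCover h2, fun ⟨_, _, hU⟩ => hU.isValid h2⟩,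
    fun _ _ hU _ _ hν ht => hU.exists_glueing h2 hν ht⟩
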